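/- Let $H(28,3)$ be the Hamming graph: its vertices are the vectors of $\mathbb{F}_3^{28}$, two of them being adjacent when they differ in exactly one coordinate. A set $C$ of vertices of a connected graph $\Gamma$ is called a completely regular code with intersection array $\{b_0,\dots,b_{r-1};c_1,\dots,c_r\}$ if the vertex set has a partition $(P_0,\dots,P_r)$ into non-empty cells with $P_0=C$ and a tridiagonal matrix $(S_{ij})_{i,j=0}^{r}$ such that every vertex of $P_i$ has exactly $S_{ij}$ neighbours in $P_j$ for all $i,j$, where $S_{i,i+1}=b_i$ and $S_{i+1,i}=c_{i+1}$ for $0\le i<r$. (Equivalently, $P_i$ is the set of vertices at distance $i$ from $C$.) A code is linear if it is a linear subspace of $\mathbb{F}_3^{28}$. There is no linear completely regular code with intersection array $\{56,42,20;1,6,28\}$ in $H(28,3)$. -/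

import Mathlib

/-- The Hamming graph `H(n, q)`, on the words of length `n` over an alphabet `α` (of size `q`):
two words are adjacent when they are at Hamming distance one. -/
def hammingGraph (n : ℕ) (α : Type*) [DecidableEq α] : SimpleGraph (Fin n → α) where
  Adj x y := hammingDist x y = 1
  symm := ⟨fun x y h => by rw [hammingDist_comm]; exact h⟩
  loopless := ⟨fun x h => by simp at h⟩

/-- The sets `P 0, …, P r` form an equitable partition of the vertex set of the graph `G`, with
intersection matrix `S`: they are non-empty, every vertex lies in exactly one of them, and every
vertex of `P i` has exactly `S i j` neighbours in `P j`. -/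
structure IsEquitablePartition {V : Type*} (G : SimpleGraph V) {r : ℕ}
    (P : Fin (r + 1) → Set V) (S : Matrix (Fin (r + 1)) (Fin (r + 1)) ℕ) : Prop where
  nonempty : ∀ i, (P i).Nonempty
  existsUnique_mem : ∀ v, ∃! i, v ∈ P i
  encard_inter : ∀ i j, ∀ v ∈ P i, (G.neighborSet v ∩ P j).encard = S i j

/-- A set `C` of vertices of a (connected) graph `G` is a completely regular code of covering
radius `r` with intersection array `{b 0, …, b (r-1); c 0, …, c (r-1)}`, where the entries
`c 0, …, c (r-1)` are those usually written `c_1, …, c_r`: it is the first cell of an equitable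
partition `P 0, …, P r` of `G` whose intersection matrix `S` is tridiagonal, with `S i (i+1) = b i`
and `S (i+1) i = c i`. As `G` is connected, `P i` is then the set of vertices at distance
`i` from `C`. -/
def IsCompletelyRegularCode {V : Type*} (G : SimpleGraph V) (C : Set V) {r : ℕ}
    (b c : Fin r → ℕ) : Prop :=
  ∃ (P : Fin (r + 1) → Set V) (S : Matrix (Fin (r + 1)) (Fin (r + 1)) ℕ),
    IsEquitablePartition G P S ∧ P 0 = C ∧
      (∀ i j : Fin (r + 1), (i : ℕ) + 1 < j ∨ (j : ℕ) + 1 < i → S i j = 0) ∧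
      (∀ i : Fin r, S i.castSucc i.succ = b i) ∧
      (∀ i : Fin r, S i.succ i.castSucc = c i)

/-! ### The adjacency algebra of the coset graph and its eigenvalues. -/

namespace DistanceScheme
open Finset

/-! The cosets of such a code form a distance-regular Cayley graph on a group `V` of order 729, that
is on `F_3^6`, with the same array. Its connection set `S` consists of the 56 vectors `±s` over 28
points of a projective space, and its eigenvalues are 56, 20, 2, -7. The contradiction comes from
the lines through a point `p` of `S` that carry three or four points of `S`. The idempotent of the
eigenvalue 20, antisymmetrised, is a positive semidefinite kernel. On `S` it has diagonal 36, and
off `±p` its values are 0 and ±18, the value -18 marking the triads of `p`. Testing it on a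
combination of `p` and its triads turns an inequality into an equality (`kern_add_kern_mate`). Hence
triads on different lines through `p` satisfy a strict dichotomy: a triad is adjacent to exactly one
of the two triads on the other line. A line inside `S` through `p` spans a clique attaining the
Delsarte bound, and the eigenvalue -7 then forces `p` to have exactly 6 tetrads (`card_tetrads`) and
6 triads. This cannot hold at every `p`: the kernel on `S` would square to 180 times itself, which
is incompatible with its trace modulo 5. So some `p` has no tetrads and 12 triads, on six lines. A
hyperplane contains 14, 20 or 32 elements of `S` (`card_ker`). This makes differences of adjacent
triads coincide only in the obvious way (`sub_eq_sub_iff`), so the 30 elements of `S` off the six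
lines are exactly these differences, and hyperplane sections through `p` can be counted on triads
alone (`two_mul_card_outer`). Suitable functionals, combined linearly, give a hyperplane with only 2
elements of `S`, which is impossible (`tetrads_nonempty`). -/

/-- The intersection matrix of the array `{56, 42, 20; 1, 6, 28}`. -/
def intersectionMatrix : Fin 4 → Fin 4 → ℕ :=
  ![![0, 56, 0, 0], ![1, 13, 42, 0], ![0, 6, 30, 20], ![0, 0, 28, 28]]

/-- `δ` is the distance from the origin in a distance-regular Cayley graph on `V` with intersection
array `{56, 42, 20; 1, 6, 28}` and connection set `{s | δ s = 1}`. -/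
structure IsDistanceScheme {V : Type*} [AddCommGroup V] [Fintype V] (δ : V → Fin 4) : Prop where
  eq_zero_iff : ∀ x, δ x = 0 ↔ x = 0
  neg : ∀ x, δ (-x) = δ x
  card : ∀ x j, #{s | δ s = 1 ∧ δ (x - s) = j} = intersectionMatrix (δ x) j

variable {V : Type*} [AddCommGroup V] [Fintype V] {δ : V → Fin 4}

/-- The `j`-th adjacency operator of the scheme. -/
def adj (δ : V → Fin 4) (j : Fin 4) (f : V → ℤ) (x : V) : ℤ :=
  ∑ z with δ z = j, f (x - z)

theorem sum_eq_sum_adj (δ : V → Fin 4) (u : Fin 4 → ℤ) (f : V → ℤ) (x : V) :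
    ∑ z, u (δ z) * f (x - z) = ∑ j, u j * adj δ j f x := by
  rw [← sum_fiberwise_of_maps_to (g := δ) (t := univ) (fun _ _ => mem_univ _)]
  refine sum_congr rfl fun j _ => ?_
  rw [adj, mul_sum]
  refine sum_congr rfl fun z hz => ?_
  rw [(mem_filter.1 hz).2]

theorem adj_comm (i j : Fin 4) (f : V → ℤ) (x : V) :
    adj δ i (adj δ j f) x = adj δ j (adj δ i f) x := by
  simp only [adj]
  rw [sum_comm]
  refine sum_congr rfl fun z _ => sum_congr rfl fun w _ => ?_
  rw [sub_right_comm]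

theorem adj_smul (j : Fin 4) (c : ℤ) (f : V → ℤ) (x : V) :
    adj δ j (fun y => c * f y) x = c * adj δ j f x := by
  simp only [adj, mul_sum]

namespace IsDistanceScheme

/-- This is the product rule of the adjacency algebra, so an eigenfunction of the graph is one for
every distance class. -/
theorem adj_one_adj (h : IsDistanceScheme δ) (j : Fin 4) (f : V → ℤ) (x : V) :
    adj δ 1 (adj δ j f) x = ∑ i, (intersectionMatrix i j : ℤ) * adj δ i f x := by
  rw [← sum_eq_sum_adj δ (fun i => (intersectionMatrix i j : ℤ)) f x]
  have h1 : ∀ s, ∑ z with δ z = j, f (x - s - z) = ∑ z with δ (z - s) = j, f (x - z) := by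
    intro s
    refine sum_bij' (fun z _ => s + z) (fun z _ => z - s) ?_ ?_ ?_ ?_ ?_ <;>
      simp +contextual [sub_sub]
  simp only [adj, h1, sum_filter]
  rw [← sum_filter, sum_comm]
  refine sum_congr rfl fun z _ => ?_
  rw [← h.card z j, ← sum_filter, sum_const, filter_filter, nsmul_eq_mul]

theorem adj_zero (h : IsDistanceScheme δ) (f : V → ℤ) (x : V) : adj δ 0 f x = f x := by
  have : univ.filter (fun z => δ z = 0) = {0} := by
    ext z; simp [h.eq_zero_iff]
  rw [adj, this, sum_singleton, sub_zero]

section Eigenfunction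

variable {f : V → ℤ} {θ : ℤ}

theorem adj_one_adj_of_eigen (hf : ∀ x, adj δ 1 f x = θ * f x) (j : Fin 4) (x : V) :
    adj δ 1 (adj δ j f) x = θ * adj δ j f x := by
  rw [adj_comm, show adj δ 1 f = fun y => θ * f y from funext hf, adj_smul]

theorem adj_two_of_eigen (h : IsDistanceScheme δ) (hf : ∀ x, adj δ 1 f x = θ * f x) (x : V) :
    6 * adj δ 2 f x = (θ ^ 2 - 13 * θ - 56) * f x := by
  have h1 := h.adj_one_adj 1 f x
  rw [adj_one_adj_of_eigen hf, hf] at h1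
  simp [Fin.sum_univ_four, intersectionMatrix, h.adj_zero, hf] at h1
  linear_combination -h1

theorem adj_three_of_eigen (h : IsDistanceScheme δ) (hf : ∀ x, adj δ 1 f x = θ * f x) (x : V) :
    28 * adj δ 3 f x = (θ - 30) * adj δ 2 f x - 42 * θ * f x := by
  have h1 := h.adj_one_adj 2 f x
  rw [adj_one_adj_of_eigen hf] at h1
  simp [Fin.sum_univ_four, intersectionMatrix, h.adj_zero, hf] at h1
  linear_combination -h1

/-- The quartic with these four roots is the characteristic polynomial of the intersection matrix.
-/
theorem eigenvalue_mem (h : IsDistanceScheme δ) (hf : ∀ x, adj δ 1 f x = θ * f x) {x : V}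
    (hx : f x ≠ 0) : θ = 56 ∨ θ = 20 ∨ θ = 2 ∨ θ = -7 := by
  have h1 := h.adj_one_adj 3 f x
  rw [adj_one_adj_of_eigen hf] at h1
  simp [Fin.sum_univ_four, intersectionMatrix, h.adj_zero, hf] at h1
  have h2 := h.adj_two_of_eigen hf x
  have h3 := h.adj_three_of_eigen hf x
  have h4 : ((θ - 56) * (θ - 20) * (θ - 2) * (θ + 7)) * f x = 0 := by
    -- The factor 168 = 6·28 clears the denominators when the second and third distance operators
    -- are eliminated.
    linear_combination 168 * h1 - ((θ - 28) * (θ - 30) - 560) * h2 - 6 * (θ - 28) * h3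
  rcases mul_eq_zero.1 h4 with h5 | h5
  · simp only [mul_eq_zero] at h5
    omega
  · exact absurd h5 hx

end Eigenfunction

/-! ### The idempotents of the eigenvalues 20 and -7. -/

theorem adj_one_class (h : IsDistanceScheme δ) (u : Fin 4 → ℤ) (x : V) :
    adj δ 1 (fun y => u (δ y)) x = ∑ j, (intersectionMatrix (δ x) j : ℤ) * u j := by
  rw [adj, ← sum_fiberwise_of_maps_to (g := fun s => δ (x - s)) (t := univ)
    (fun _ _ => mem_univ _)]
  refine sum_congr rfl fun j _ => ?_
  rw [sum_congr rfl (g := fun _ => u j) fun z hz => by rw [(mem_filter.1 hz).2],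
    sum_const, filter_filter, h.card, nsmul_eq_mul]

/-- The cosine sequence of the eigenvalue `20`, scaled by its multiplicity `56`. -/
def cosTwenty : Fin 4 → ℤ := ![56, 20, 2, -7]

/-- The cosine sequence of the eigenvalue `-7`, scaled by its multiplicity `280`. -/
def cosNegSeven : Fin 4 → ℤ := ![280, -35, 10, -8]

theorem eigen_cosTwenty (h : IsDistanceScheme δ) (x : V) :
    adj δ 1 (fun y => cosTwenty (δ y)) x = 20 * cosTwenty (δ x) := by
  rw [h.adj_one_class]
  generalize δ x = i
  fin_cases i <;> decide

theorem eigen_cosNegSeven (h : IsDistanceScheme δ) (x : V) :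
    adj δ 1 (fun y => cosNegSeven (δ y)) x = (-7) * cosNegSeven (δ x) := by
  rw [h.adj_one_class]
  generalize δ x = i
  fin_cases i <;> decide

/-- The cosine sequence scaled by its multiplicity is 729 times a primitive idempotent, hence this
reproducing identity. -/
theorem conv_cosTwenty (h : IsDistanceScheme δ) (x : V) :
    ∑ z, cosTwenty (δ z) * cosTwenty (δ (x - z)) = 729 * cosTwenty (δ x) := by
  rw [sum_eq_sum_adj δ cosTwenty (fun y => cosTwenty (δ y)) x]
  have h2 := h.adj_two_of_eigen h.eigen_cosTwenty x
  have h3 := h.adj_three_of_eigen h.eigen_cosTwenty x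
  have h1 := h.eigen_cosTwenty x
  have h0 := h.adj_zero (fun y => cosTwenty (δ y)) x
  simp only [Fin.sum_univ_four, cosTwenty, Matrix.cons_val] at *
  omega

theorem conv_cosNegSeven (h : IsDistanceScheme δ) (x : V) :
    ∑ z, cosNegSeven (δ z) * cosNegSeven (δ (x - z)) = 729 * cosNegSeven (δ x) := by
  rw [sum_eq_sum_adj δ cosNegSeven (fun y => cosNegSeven (δ y)) x]
  have h2 := h.adj_two_of_eigen h.eigen_cosNegSeven x
  have h3 := h.adj_three_of_eigen h.eigen_cosNegSeven x
  have h1 := h.eigen_cosNegSeven x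
  have h0 := h.adj_zero (fun y => cosNegSeven (δ y)) x
  simp only [Fin.sum_univ_four, cosNegSeven, Matrix.cons_val] at *
  omega

theorem card_sphere (h : IsDistanceScheme δ) :
    #{z | δ z = 1} = 56 := by
  have := h.card 0 1
  rw [(h.eq_zero_iff 0).2 rfl] at this
  simp only [zero_sub, h.neg, and_self] at this
  exact this

theorem card_eq (h : IsDistanceScheme δ) : Fintype.card V = 729 := by
  have h1 : ∀ x, adj δ 1 (fun _ => 1) x = 56 * (fun _ : V => (1 : ℤ)) x := by
    intro x; simp [adj, h.card_sphere]
  have h2 := h.adj_two_of_eigen h1 0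
  have h3 := h.adj_three_of_eigen h1 0
  have h0 := h.adj_zero (fun _ => 1) 0
  have h1 := h1 0
  have := sum_eq_sum_adj δ (fun _ => 1) (fun _ => 1) 0
  simp only [Fin.sum_univ_four, mul_one, sum_const, card_univ, nsmul_eq_mul, one_mul] at *
  omega

end IsDistanceScheme

/-! ### The antisymmetrised kernel and points of the connection set. -/

/-- The antisymmetrised kernel of the projection onto the eigenspace of the eigenvalue `20`. -/
def kern (δ : V → Fin 4) (x y : V) : ℤ :=
  IsDistanceScheme.cosTwenty (δ (x - y)) - IsDistanceScheme.cosTwenty (δ (x + y))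

/-- The words `s` of the connection set for which `p`, `s`, `-p-s` span a line of the projective
space that has exactly three points in the connection set. -/
def triads (δ : V → Fin 4) (p : V) : Finset V := {s | δ s = 1 ∧ δ (p + s) = 1 ∧ δ (p - s) = 2}

/-- The words `s` of the connection set, other than `±p`, for which all nonzero combinations of
`p` and `s` lie in the connection set. -/
def tetrads (δ : V → Fin 4) (p : V) : Finset V := {s | δ s = 1 ∧ δ (p + s) = 1 ∧ δ (p - s) = 1}

theorem mem_triads {p s : V} :
    s ∈ triads δ p ↔ δ s = 1 ∧ δ (p + s) = 1 ∧ δ (p - s) = 2 := by simp [triads]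

theorem mem_tetrads {p s : V} :
    s ∈ tetrads δ p ↔ δ s = 1 ∧ δ (p + s) = 1 ∧ δ (p - s) = 1 := by simp [tetrads]

namespace IsDistanceScheme

theorem sub_comm (h : IsDistanceScheme δ) (x y : V) : δ (x - y) = δ (y - x) := by
  rw [← neg_sub, h.neg]

theorem zero (h : IsDistanceScheme δ) : δ 0 = 0 := (h.eq_zero_iff 0).2 rfl

theorem ne_zero_of_one (h : IsDistanceScheme δ) {x : V} (hx : δ x = 1) : x ≠ 0 := by
  rintro rfl
  rw [h.zero] at hx
  exact absurd hx (by decide)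

theorem ne_zero_of_two (h : IsDistanceScheme δ) {x : V} (hx : δ x = 2) : x ≠ 0 := by
  rintro rfl
  rw [h.zero] at hx
  exact absurd hx (by decide)

theorem sub_eq_one_or_two (h : IsDistanceScheme δ) {s t : V} (hs : δ s = 1) (ht : δ t = 1)
    (hst : s ≠ t) : δ (s - t) = 1 ∨ δ (s - t) = 2 := by
  have h0 : δ (s - t) ≠ 0 := fun h0 => hst (sub_eq_zero.1 ((h.eq_zero_iff _).1 h0))
  have h3 : δ (s - t) ≠ 3 := by
    intro h3
    have := h.card s 3
    rw [hs, show intersectionMatrix 1 3 = 0 from rfl, card_eq_zero] at this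
    have hm : t ∈ ({u | δ u = 1 ∧ δ (s - u) = 3} : Finset V) := by simp [ht, h3]
    rw [this] at hm
    simp at hm
  revert h0 h3
  generalize δ (s - t) = i
  revert i
  decide

theorem add_eq_one_or_two (h : IsDistanceScheme δ) {s t : V} (hs : δ s = 1) (ht : δ t = 1)
    (hst : s ≠ -t) : δ (s + t) = 1 ∨ δ (s + t) = 2 := by
  have := h.sub_eq_one_or_two hs ((h.neg t).trans ht) hst
  rwa [sub_neg_eq_add] at this

theorem kern_comm (h : IsDistanceScheme δ) (x y : V) : kern δ x y = kern δ y x := by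
  rw [kern, kern, h.sub_comm, add_comm]

theorem kern_neg_left (h : IsDistanceScheme δ) (x y : V) : kern δ (-x) y = -kern δ x y := by
  rw [kern, kern, ← h.neg (-x - y), ← h.neg (-x + y)]
  simp only [neg_sub', neg_neg, neg_add, sub_neg_eq_add, ← sub_eq_add_neg]
  ring

theorem conv_cosTwenty_shift (h : IsDistanceScheme δ) (x y : V) :
    ∑ z, cosTwenty (δ (x - z)) * cosTwenty (δ (z - y)) = 729 * cosTwenty (δ (x - y)) := by
  rw [← h.conv_cosTwenty (x - y)]
  refine Fintype.sum_equiv (Equiv.subRight y) _ _ fun z => ?_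
  rw [mul_comm, Equiv.subRight_apply, sub_sub_sub_cancel_right]

/-- The kernel is a multiple of a projection; the factor is 2·729 because antisymmetrising doubles
the idempotent. Positive semidefiniteness follows. -/
theorem sum_kern_mul_kern (h : IsDistanceScheme δ) (x y : V) :
    ∑ z, kern δ x z * kern δ y z = 1458 * kern δ x y := by
  have e1 := h.conv_cosTwenty_shift x y
  have e2 := h.conv_cosTwenty_shift x (-y)
  have e3 := h.conv_cosTwenty_shift (-x) y
  have e4 := h.conv_cosTwenty_shift (-x) (-y)
  have n1 : ∀ a b : V, δ (-a - b) = δ (a + b) := fun a b => by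
    rw [← h.neg, neg_sub', neg_neg, sub_neg_eq_add]
  simp only [n1, sub_neg_eq_add] at e1 e2 e3 e4
  have : ∀ z, kern δ x z * kern δ y z =
      cosTwenty (δ (x - z)) * cosTwenty (δ (z - y)) - cosTwenty (δ (x - z)) * cosTwenty (δ (z + y))
      - cosTwenty (δ (x + z)) * cosTwenty (δ (z - y))
      + cosTwenty (δ (x + z)) * cosTwenty (δ (z + y)) := by
    intro z
    rw [kern, kern, h.sub_comm y z, add_comm y z]
    ring
  simp only [this, sum_add_distrib, sum_sub_distrib, e1, e2, e3]
  rw [← h.neg (-x + y)] at e4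
  simp only [neg_add, neg_neg, ← sub_eq_add_neg] at e4
  rw [e4, kern]
  ring

/-- The quadratic form of the kernel at `a p + b ∑ T` is exhibited as a sum of squares, which gives
both its sign and its null vectors. -/
theorem sum_sq_kern (h : IsDistanceScheme δ) (a b : ℤ) (p : V) (T : Finset V) :
    ∑ q, (a * kern δ p q + b * ∑ s ∈ T, kern δ s q) ^ 2 =
      1458 * (a ^ 2 * kern δ p p + 2 * a * b * ∑ s ∈ T, kern δ p s +
        b ^ 2 * ∑ s ∈ T, ∑ t ∈ T, kern δ s t) := by
  have h1 : ∀ q, (a * kern δ p q + b * ∑ s ∈ T, kern δ s q) ^ 2 =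
      a ^ 2 * (kern δ p q * kern δ p q) + 2 * a * b * ∑ s ∈ T, kern δ p q * kern δ s q
      + b ^ 2 * ∑ s ∈ T, ∑ t ∈ T, kern δ s q * kern δ t q := by
    intro q
    rw [← mul_sum, ← sum_mul_sum]
    ring
  have h2 : ∑ q, ∑ s ∈ T, kern δ p q * kern δ s q = 1458 * ∑ s ∈ T, kern δ p s := by
    rw [sum_comm, mul_sum]
    exact sum_congr rfl fun s _ => h.sum_kern_mul_kern p s
  have h3 : ∑ q, ∑ s ∈ T, ∑ t ∈ T, kern δ s q * kern δ t q =
      1458 * ∑ s ∈ T, ∑ t ∈ T, kern δ s t := by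
    rw [sum_comm, mul_sum]
    refine sum_congr rfl fun s _ => ?_
    rw [sum_comm, mul_sum]
    exact sum_congr rfl fun t _ => h.sum_kern_mul_kern s t
  rw [sum_congr rfl fun q _ => h1 q]
  rw [sum_add_distrib, sum_add_distrib, ← mul_sum, ← mul_sum, ← mul_sum, h2, h3,
    h.sum_kern_mul_kern]
  ring

end IsDistanceScheme

/-! ### Lines with exactly three points in the connection set. -/

section CharThree

variable [Module (ZMod 3) V]

set_option linter.unusedSectionVars false
set_option linter.unnecessarySeqFocus false

theorem add_self_eq_neg (x : V) : x + x = -x := by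
  -- Coefficients live in `ZMod 3`, so matching scalars leaves closed identities for `decide`. With
  -- a zero multiple of a trivial equation, this checks a formal identity in characteristic 3.
  linear_combination (norm := (match_scalars <;> decide)) (0 : ZMod 3) • (rfl : x = x)

namespace IsDistanceScheme

theorem mem_triads_ne (h : IsDistanceScheme δ) {p s : V} (hs : s ∈ triads δ p) :
    s ≠ 0 ∧ s ≠ p ∧ s ≠ -p := by
  obtain ⟨h1, h2, h3⟩ := mem_triads.1 hs
  refine ⟨h.ne_zero_of_one h1, ?_, ?_⟩
  · rintro rfl
    exact h.ne_zero_of_two h3 (sub_self _)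
  · rintro rfl
    exact h.ne_zero_of_one h2 (add_neg_cancel p)

theorem mate_mem_triads (h : IsDistanceScheme δ) {p s : V} (hs : s ∈ triads δ p) :
    -p - s ∈ triads δ p := by
  obtain ⟨h1, h2, h3⟩ := mem_triads.1 hs
  refine mem_triads.2 ⟨?_, ?_, ?_⟩
  · rw [← h.neg]; simpa [add_comm] using h2
  · rwa [add_sub, add_neg_cancel, zero_sub, h.neg]
  · rw [show p - (-p - s) = -(p - s) by
      linear_combination (norm := (match_scalars <;> decide)) (0 : ZMod 3) • (rfl : p = p), h.neg]
    exact h3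

theorem mate_ne (h : IsDistanceScheme δ) {p s : V} (hs : s ∈ triads δ p) : -p - s ≠ s := by
  intro e
  refine (h.mem_triads_ne hs).2.1 ?_
  linear_combination (norm := (match_scalars <;> decide)) (1 : ZMod 3) • e

theorem neg_notMem_triads {p s : V} (hs : s ∈ triads δ p) : -s ∉ triads δ p := by
  intro hs'
  have h1 := (mem_triads.1 hs).2.2
  have h2 := (mem_triads.1 hs').2.1
  rw [← sub_eq_add_neg, h1] at h2
  exact absurd h2 (by decide)

/-- Since `p - s` is at distance 2 and `c_2 = 6`, the six points on the line of `p` and `s` already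
exhaust the common neighbours of `0` and `p - s`. -/
theorem mem_of_sub_sub_eq_one (h : IsDistanceScheme δ) [DecidableEq V] {p s m : V} (hp : δ p = 1)
    (hs : s ∈ triads δ p) (hm : δ m = 1) (hm' : δ (p - s - m) = 1) :
    m ∈ ({p, -p, s, -s, p + s, -(p + s)} : Finset V) := by
  obtain ⟨h1, h2, h3⟩ := mem_triads.1 hs
  obtain ⟨n0, n1, n2⟩ := h.mem_triads_ne hs
  have np := h.ne_zero_of_one hp
  have hc := h.card (p - s) 1
  rw [h3, show intersectionMatrix 2 1 = 6 from rfl] at hc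
  have hsub : ({p, -p, s, -s, p + s, -(p + s)} : Finset V) ⊆
      univ.filter fun m => δ m = 1 ∧ δ (p - s - m) = 1 := by
    have e1 : p - s - -p = -(p + s) := by
      linear_combination (norm := (match_scalars <;> decide)) (0 : ZMod 3) • (rfl : p = p)
    have e2 : p - s - s = p + s := by
      linear_combination (norm := (match_scalars <;> decide)) (0 : ZMod 3) • (rfl : p = p)
    have e3 : p - s - (p + s) = s := by
      linear_combination (norm := (match_scalars <;> decide)) (0 : ZMod 3) • (rfl : p = p)
    have e4 : p - s - -(p + s) = -p := by
      linear_combination (norm := (match_scalars <;> decide)) (0 : ZMod 3) • (rfl : p = p)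
    intro x hx
    simp only [mem_insert, mem_singleton] at hx
    rw [mem_filter_univ]
    rcases hx with rfl | rfl | rfl | rfl | rfl | rfl
    · exact ⟨hp, by rwa [sub_sub_cancel_left, h.neg]⟩
    · exact ⟨by rwa [h.neg], by rwa [e1, h.neg]⟩
    · exact ⟨h1, by rwa [e2]⟩
    · exact ⟨by rwa [h.neg], by simpa using hp⟩
    · exact ⟨h2, by rwa [e3]⟩
    · exact ⟨by rwa [h.neg], by rwa [e4, h.neg]⟩
  have hcard : #({p, -p, s, -s, p + s, -(p + s)} : Finset V) = 6 := by
    repeat rw [card_insert_of_notMem]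
    · rfl
    all_goals
      simp only [mem_insert, mem_singleton, not_or]
      try refine ⟨?_, ?_⟩
    all_goals try refine ⟨?_, ?_⟩
    all_goals try refine ⟨?_, ?_⟩
    all_goals try refine ⟨?_, ?_⟩
    all_goals
      intro e
      first
      | (refine np ?_; linear_combination (norm := (match_scalars <;> decide)) (1 : ZMod 3) • e)
      | (refine np ?_; linear_combination (norm := (match_scalars <;> decide)) (2 : ZMod 3) • e)
      | (refine n0 ?_; linear_combination (norm := (match_scalars <;> decide)) (1 : ZMod 3) • e)
      | (refine n0 ?_; linear_combination (norm := (match_scalars <;> decide)) (2 : ZMod 3) • e)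
      | (refine n1 ?_; linear_combination (norm := (match_scalars <;> decide)) (1 : ZMod 3) • e)
      | (refine n1 ?_; linear_combination (norm := (match_scalars <;> decide)) (2 : ZMod 3) • e)
      | (refine n2 ?_; linear_combination (norm := (match_scalars <;> decide)) (1 : ZMod 3) • e)
      | (refine n2 ?_; linear_combination (norm := (match_scalars <;> decide)) (2 : ZMod 3) • e)
  have := eq_of_subset_of_card_le hsub (by rw [hc, hcard])
  rw [this]
  simp [hm, hm']

/-- The two differences add up to `p + 2s = p - s`, so both being in the connection set would make
`s - t` one of the six known common neighbours; each of them is excluded. -/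
theorem not_sub_and_sub_mate (h : IsDistanceScheme δ) {p s t : V} (hp : δ p = 1)
    (hs : s ∈ triads δ p) (ht : t ∈ triads δ p) (h1 : δ (s - t) = 1) :
    δ (s - (-p - t)) ≠ 1 := by
  classical
  intro h2
  obtain ⟨a1, a2, a3⟩ := mem_triads.1 hs
  obtain ⟨b1, b2, b3⟩ := mem_triads.1 ht
  obtain ⟨t0, -, tp⟩ := h.mem_triads_ne ht
  have e : p - s - (s - t) = s - (-p - t) := by
    linear_combination (norm := (match_scalars <;> decide)) (0 : ZMod 3) • (rfl : p = p)
  have hm := h.mem_of_sub_sub_eq_one hp hs h1 (e ▸ h2)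
  simp only [mem_insert, mem_singleton] at hm
  rcases hm with hm | hm | hm | hm | hm | hm
  · have : t = -(p - s) := by
      linear_combination (norm := (match_scalars <;> decide)) (-1 : ZMod 3) • hm
    rw [this, h.neg, a3] at b1
    exact absurd b1 (by decide)
  · have : p - t = -s := by
      linear_combination (norm := (match_scalars <;> decide)) (1 : ZMod 3) • hm
    rw [this, h.neg, a1] at b3
    exact absurd b3 (by decide)
  · exact t0 (by linear_combination (norm := (match_scalars <;> decide)) (-1 : ZMod 3) • hm)
  · have : p + t = p - s := by
      linear_combination (norm := (match_scalars <;> decide)) (-1 : ZMod 3) • hm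
    rw [this, a3] at b2
    exact absurd b2 (by decide)
  · exact tp (by linear_combination (norm := (match_scalars <;> decide)) (-1 : ZMod 3) • hm)
  · have : t = p - s := by
      linear_combination (norm := (match_scalars <;> decide)) (-1 : ZMod 3) • hm
    rw [this, a3] at b1
    exact absurd b1 (by decide)

theorem kern_self (h : IsDistanceScheme δ) {s : V} (hs : δ s = 1) : kern δ s s = 36 := by
  rw [kern, sub_self, add_self_eq_neg, h.neg, hs, h.zero]
  decide

theorem kern_of_mem_triads {p s : V} (hs : s ∈ triads δ p) : kern δ p s = -18 := by
  obtain ⟨-, h2, h3⟩ := mem_triads.1 hs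
  rw [kern, h2, h3]
  decide

theorem kern_mate (h : IsDistanceScheme δ) {p s : V} (hp : δ p = 1) (hs : s ∈ triads δ p) :
    kern δ s (-p - s) = -18 := by
  obtain ⟨-, -, h3⟩ := mem_triads.1 hs
  have e : s - (-p - s) = p - s := by
    linear_combination (norm := (match_scalars <;> decide)) (0 : ZMod 3) • (rfl : p = p)
  rw [kern, e, h3, add_sub_cancel, h.neg, hp]
  decide

theorem kern_le (h : IsDistanceScheme δ) {p s t : V} (hs : s ∈ triads δ p) (ht : t ∈ triads δ p)
    (hst : t ≠ s) : (δ (s - t) = 1 ∧ kern δ s t ≤ 18) ∨ (δ (s - t) ≠ 1 ∧ kern δ s t ≤ 0) := by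
  have hneg : s ≠ -t := fun e => neg_notMem_triads ht (e ▸ hs)
  have a1 := (mem_triads.1 hs).1
  have b1 := (mem_triads.1 ht).1
  rw [kern]
  rcases h.sub_eq_one_or_two a1 b1 hst.symm with h1 | h1 <;>
  rcases h.add_eq_one_or_two a1 b1 hneg with h2 | h2 <;> rw [h1, h2] <;> decide

theorem mate_mate (p s : V) : -p - (-p - s) = s := sub_sub_cancel _ _

/-- For `t` on the line of `s` the sum is 36 - 18. Otherwise a positive kernel value needs
adjacency, and `s` is adjacent to at most one of `t` and its mate. -/
theorem kern_add_kern_mate_le (h : IsDistanceScheme δ) {p s t : V} (hp : δ p = 1)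
    (hs : s ∈ triads δ p) (ht : t ∈ triads δ p) : kern δ s t + kern δ s (-p - t) ≤ 18 := by
  by_cases h1 : t = s
  · rw [h1, h.kern_mate hp hs, h.kern_self (mem_triads.1 hs).1]
    decide
  by_cases h2 : -p - t = s
  · have h3 : t = -p - s := by rw [← h2, mate_mate]
    rw [h2, h3, h.kern_mate hp hs, h.kern_self (mem_triads.1 hs).1]
    decide
  have k1 := h.kern_le hs ht h1
  have k2 := h.kern_le hs (h.mate_mem_triads ht) h2
  have k3 := h.not_sub_and_sub_mate hp hs ht
  by_cases h4 : δ (s - t) = 1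
  · have := k3 h4
    omega
  · omega

theorem sum_triads_mate {M : Type*} [AddCommMonoid M] (h : IsDistanceScheme δ) (p : V)
    (f : V → M) : ∑ t ∈ triads δ p, f (-p - t) = ∑ t ∈ triads δ p, f t :=
  sum_nbij' (fun t => -p - t) (fun t => -p - t) (fun _ ht => h.mate_mem_triads ht)
    (fun _ ht => h.mate_mem_triads ht) (fun t _ => mate_mate p t) (fun t _ => mate_mate p t)
    fun _ _ => rfl

theorem two_mul_sum_kern (h : IsDistanceScheme δ) (p : V) :
    2 * ∑ s ∈ triads δ p, ∑ t ∈ triads δ p, kern δ s t =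
      ∑ s ∈ triads δ p, ∑ t ∈ triads δ p, (kern δ s t + kern δ s (-p - t)) := by
  rw [mul_sum]
  refine sum_congr rfl fun s _ => ?_
  rw [sum_add_distrib, h.sum_triads_mate p (fun t => kern δ s t), two_mul]

/-- With `n` triads the form at `n p + 2 ∑ T` is `-36 n² + 4 ∑∑ kern`, which is minus twice the
total defect from the bound 18. A nonnegative quantity thus equals a nonpositive one. -/
theorem quadratic_form_eq (h : IsDistanceScheme δ) {p : V} (hp : δ p = 1) :
    ∑ q, (#(triads δ p) * kern δ p q + 2 * ∑ s ∈ triads δ p, kern δ s q) ^ 2 =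
      -2916 * ∑ s ∈ triads δ p, ∑ t ∈ triads δ p, (18 - (kern δ s t + kern δ s (-p - t))) := by
  rw [h.sum_sq_kern, h.kern_self hp, sum_congr rfl fun s hs => kern_of_mem_triads hs]
  simp only [sum_sub_distrib, ← h.two_mul_sum_kern, sum_const, nsmul_eq_mul]
  ring

theorem sum_defect_eq_zero (h : IsDistanceScheme δ) {p : V} (hp : δ p = 1) :
    ∑ s ∈ triads δ p, ∑ t ∈ triads δ p, (18 - (kern δ s t + kern δ s (-p - t))) = 0 := by
  have h1 := h.quadratic_form_eq hp
  have h2 : 0 ≤ ∑ q, (#(triads δ p) * kern δ p q + 2 * ∑ s ∈ triads δ p, kern δ s q) ^ 2 :=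
    sum_nonneg fun q _ => sq_nonneg _
  have h3 : 0 ≤ ∑ s ∈ triads δ p, ∑ t ∈ triads δ p, (18 - (kern δ s t + kern δ s (-p - t))) :=
    sum_nonneg fun s hs => sum_nonneg fun t ht => by
      have := h.kern_add_kern_mate_le hp hs ht
      omega
  omega

theorem kern_add_kern_mate (h : IsDistanceScheme δ) {p s t : V} (hp : δ p = 1)
    (hs : s ∈ triads δ p) (ht : t ∈ triads δ p) : kern δ s t + kern δ s (-p - t) = 18 := by
  have h0 : ∀ s ∈ triads δ p, ∀ t ∈ triads δ p, 0 ≤ 18 - (kern δ s t + kern δ s (-p - t)) := by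
    intro s hs t ht
    have := h.kern_add_kern_mate_le hp hs ht
    omega
  have h1 := (sum_eq_zero_iff_of_nonneg fun s hs => sum_nonneg (h0 s hs)).1
    (h.sum_defect_eq_zero hp) s hs
  have h2 := (sum_eq_zero_iff_of_nonneg (h0 s hs)).1 h1 t ht
  omega

/-- The combination of `p` and its triads on which the quadratic form vanishes is in the kernel. -/
theorem kern_relation (h : IsDistanceScheme δ) {p : V} (hp : δ p = 1) (q : V) :
    #(triads δ p) * kern δ p q + 2 * ∑ s ∈ triads δ p, kern δ s q = 0 := by
  have h1 := h.quadratic_form_eq hp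
  rw [h.sum_defect_eq_zero hp, mul_zero] at h1
  exact pow_eq_zero_iff two_ne_zero |>.1
    ((sum_eq_zero_iff_of_nonneg fun q _ => sq_nonneg _).1 h1 q (mem_univ q))

/-- Two triads from different lines through `p`, the second one suitably chosen on its line,
differ by an element of the connection set. -/
theorem sub_eq_one_or_sub_mate_eq_one (h : IsDistanceScheme δ) {p s t : V} (hp : δ p = 1)
    (hs : s ∈ triads δ p) (ht : t ∈ triads δ p) (h1 : t ≠ s) (h2 : t ≠ -p - s) :
    (δ (s - t) = 1 ∧ δ (s - (-p - t)) ≠ 1 ∨ δ (s - t) ≠ 1 ∧ δ (s - (-p - t)) = 1) ∧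
      δ (s + t) = 2 := by
  have h2' : -p - t ≠ s := fun e => h2 (by rw [← e, mate_mate])
  have k := h.kern_add_kern_mate hp hs ht
  have k1 := h.kern_le hs ht h1
  have k2 := h.kern_le hs (h.mate_mem_triads ht) h2'
  have k3 := h.not_sub_and_sub_mate hp hs ht
  have hneg : s ≠ -t := fun e => neg_notMem_triads ht (e ▸ hs)
  have a1 := (mem_triads.1 hs).1
  have b1 := (mem_triads.1 ht).1
  have h4 := h.add_eq_one_or_two a1 b1 hneg
  have h5 : δ (s + t) = 1 → kern δ s t ≠ 18 ∧ (δ (s - t) ≠ 1 → kern δ s t ≠ 0) := by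
    intro h5
    rw [kern, h5]
    rcases h.sub_eq_one_or_two a1 b1 h1.symm with h6 | h6 <;> rw [h6] <;> decide
  by_cases h6 : δ (s - t) = 1
  · have := k3 h6
    refine ⟨Or.inl ⟨h6, this⟩, h4.resolve_left fun h7 => ?_⟩
    have := h5 h7
    omega
  · refine ⟨Or.inr ⟨h6, by_contra fun h7 => ?_⟩, h4.resolve_left fun h7 => ?_⟩
    · omega
    · have := h5 h7
      have := this.2 h6
      omega

end IsDistanceScheme

theorem zmod_three_cases (a : ZMod 3) : a = 0 ∨ a = 1 ∨ a = -1 := by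
  revert a
  decide

/-! ### Planes inside the connection set. -/

namespace IsDistanceScheme

/-- The diagonal entry 13 counts the common neighbours of `0` and `p`; one of them is `-p`, and the
negatives of the others are triads or tetrads. -/
theorem card_triads_add_card_tetrads (h : IsDistanceScheme δ) {p : V} (hp : δ p = 1) :
    #(triads δ p) + #(tetrads δ p) = 12 := by
  classical
  have h1 := h.card p 1
  rw [hp, show intersectionMatrix 1 1 = 13 from rfl] at h1
  have h2 : #{s | δ s = 1 ∧ δ (p - s) = 1} = #(insert p (triads δ p ∪ tetrads δ p)) := by
    refine card_nbij' (fun s => -s) (fun s => -s) ?_ ?_ (fun _ _ => neg_neg _)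
      (fun _ _ => neg_neg _)
    · intro s hs
      obtain ⟨hs1, hs2⟩ := (mem_filter.1 hs).2
      rw [mem_coe, mem_insert, mem_union, mem_triads, mem_tetrads, h.neg, ← sub_eq_add_neg,
        sub_neg_eq_add]
      by_cases hsp : -s = p
      · exact Or.inl hsp
      · have hne : p ≠ -s := fun e => hsp e.symm
        rcases h.add_eq_one_or_two hp hs1 hne with h3 | h3
        · exact Or.inr (Or.inr ⟨hs1, hs2, h3⟩)
        · exact Or.inr (Or.inl ⟨hs1, hs2, h3⟩)
    · intro s hs
      rw [mem_coe, mem_insert, mem_union, mem_triads, mem_tetrads] at hs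
      rw [mem_coe, mem_filter_univ, h.neg, sub_neg_eq_add]
      rcases hs with rfl | ⟨h3, h4, -⟩ | ⟨h3, h4, -⟩
      · exact ⟨hp, by rw [add_self_eq_neg, h.neg, hp]⟩
      · exact ⟨h3, h4⟩
      · exact ⟨h3, h4⟩
  have h3 : p ∉ triads δ p ∪ tetrads δ p := by
    rw [mem_union, mem_triads, mem_tetrads, sub_self, h.zero]
    rintro (⟨-, -, h3⟩ | ⟨-, -, h3⟩) <;> exact absurd h3 (by decide)
  have h4 : Disjoint (triads δ p) (tetrads δ p) := by
    rw [disjoint_left]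
    intro s hs ht
    have h5 := (mem_triads.1 hs).2.2
    rw [(mem_tetrads.1 ht).2.2] at h5
    exact absurd h5 (by decide)
  rw [h1, card_insert_of_notMem h3, card_union_of_disjoint h4] at h2
  omega

theorem eq_one_of_mem_tetrads (h : IsDistanceScheme δ) {p f : V} (hp : δ p = 1)
    (hf : f ∈ tetrads δ p) {i : ZMod 3 × ZMod 3} (hi : i ≠ 0) : δ (i.1 • p + i.2 • f) = 1 := by
  obtain ⟨h1, h2, h3⟩ := mem_tetrads.1 hf
  obtain ⟨a, b⟩ := i
  have e1 : -p + f = -(p - f) := by abel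
  have e2 : -p + -f = -(p + f) := by abel
  have e3 : p + -f = p - f := by abel
  rcases zmod_three_cases a with rfl | rfl | rfl <;>
  rcases zmod_three_cases b with rfl | rfl | rfl <;>
  simp only [zero_smul, one_smul, neg_smul, zero_add, add_zero, e1, e2, e3, h.neg] <;>
  first | assumption | exact absurd rfl hi

theorem conv_cosNegSeven_shift (h : IsDistanceScheme δ) (x y : V) :
    ∑ z, cosNegSeven (δ (x - z)) * cosNegSeven (δ (y - z)) = 729 * cosNegSeven (δ (x - y)) := by
  rw [← h.conv_cosNegSeven (x - y)]
  refine Fintype.sum_equiv (Equiv.subRight y) _ _ fun z => ?_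
  rw [mul_comm, Equiv.subRight_apply, sub_sub_sub_cancel_right, h.sub_comm y z]

/-- A plane contained in the connection set (but for the origin) is a clique that attains the
Delsarte bound, so its characteristic function is orthogonal to the eigenspace of `-7`. -/
theorem sum_plane_eq_zero (h : IsDistanceScheme δ) {p f : V} (hp : δ p = 1)
    (hf : f ∈ tetrads δ p) (z : V) :
    ∑ i : ZMod 3 × ZMod 3, cosNegSeven (δ (i.1 • p + i.2 • f - z)) = 0 := by
  have h1 : ∑ i : ZMod 3 × ZMod 3, cosNegSeven (δ (i.1 • p + i.2 • f)) = 0 := by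
    have : ∀ i : ZMod 3 × ZMod 3, cosNegSeven (δ (i.1 • p + i.2 • f)) =
        if i = 0 then 280 else -35 := by
      intro i
      split_ifs with hi
      · rw [hi, Prod.fst_zero, Prod.snd_zero, zero_smul, zero_smul, add_zero, h.zero]
        decide
      · rw [h.eq_one_of_mem_tetrads hp hf hi]
        decide
    rw [sum_congr rfl fun i _ => this i]
    decide
  have h2 : ∑ z, (∑ i : ZMod 3 × ZMod 3, cosNegSeven (δ (i.1 • p + i.2 • f - z))) ^ 2 = 0 := by
    simp only [sq, sum_mul_sum]
    rw [sum_comm]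
    refine sum_eq_zero fun i _ => ?_
    rw [sum_comm]
    simp only [h.conv_cosNegSeven_shift]
    rw [← mul_sum, ← h1.symm.trans (Fintype.sum_equiv (Equiv.subLeft i) _ _ fun j => ?_), mul_zero]
    rw [Equiv.subLeft_apply, Prod.fst_sub, Prod.snd_sub]
    congr 2
    module
  exact pow_eq_zero_iff two_ne_zero |>.1
    ((sum_eq_zero_iff_of_nonneg fun q _ => sq_nonneg _).1 h2 z (mem_univ z))

/-- A tetrad outside the plane of `p` and `f` would violate `sum_plane_eq_zero`, so the tetrads are
the nine points of that plane minus the three on the line of `p`. -/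
theorem card_tetrads (h : IsDistanceScheme δ) {p : V} (hp : δ p = 1)
    (hne : (tetrads δ p).Nonempty) : #(tetrads δ p) = 6 := by
  classical
  obtain ⟨f, hf⟩ := hne
  let w : ZMod 3 × ZMod 3 → V := fun i => i.1 • p + i.2 • f
  have hw : ∀ i, i ≠ 0 → δ (w i) = 1 := fun i hi => h.eq_one_of_mem_tetrads hp hf hi
  have hinj : Function.Injective w := by
    intro i j hij
    by_contra hne
    refine h.ne_zero_of_one (hw (i - j) (sub_ne_zero.2 hne)) ?_
    have : w (i - j) = w i - w j := by
      simp only [w, Prod.fst_sub, Prod.snd_sub]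
      module
    rw [this, hij, sub_self]
  have himg : tetrads δ p = (univ.filter fun i : ZMod 3 × ZMod 3 => i.2 ≠ 0).image w := by
    ext z
    rw [mem_image]
    constructor
    · intro hz
      obtain ⟨z1, z2, z3⟩ := mem_tetrads.1 hz
      by_contra hcon
      -- The three multiples of `p` contribute -35 each and the other six points at most 10 each, so
      -- the sum is at most -45.
      have hlt : ∑ i : ZMod 3 × ZMod 3, cosNegSeven (δ (w i - z)) ≤
          ∑ i : ZMod 3 × ZMod 3, if i.2 = 0 then -35 else 10 := by
        refine sum_le_sum fun i _ => ?_
        split_ifs with hi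
        · have e1 : -p - z = -(p + z) := by abel
          have : δ (w i - z) = 1 := by
            rcases zmod_three_cases i.1 with h1 | h1 | h1 <;>
            simp only [w, hi, h1, zero_smul, one_smul, neg_smul, add_zero, zero_sub, h.neg, e1] <;>
            assumption
          rw [this]
          decide
        · have hne : w i ≠ z := fun e => hcon ⟨i, by simp [hi], e⟩
          have hi0 : i ≠ 0 := fun e => hi (by rw [e]; rfl)
          rcases h.sub_eq_one_or_two (hw i hi0) z1 hne with h1 | h1 <;> rw [h1] <;> decide
      rw [h.sum_plane_eq_zero hp hf z] at hlt
      exact absurd hlt (by decide)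
    · rintro ⟨i, hi, rfl⟩
      have hi2 : i.2 ≠ 0 := (mem_filter.1 hi).2
      have e1 : p + w i = w (i + (1, 0)) := by
        simp only [w, Prod.fst_add, Prod.snd_add, add_zero]
        module
      have e2 : p - w i = w ((1, 0) - i) := by
        simp only [w, Prod.fst_sub, Prod.snd_sub, zero_sub]
        module
      rw [mem_tetrads, e1, e2]
      refine ⟨hw _ ?_, hw _ ?_, hw _ ?_⟩
      · exact fun e => hi2 (by rw [e]; rfl)
      · exact fun e => hi2 (by simpa using congrArg Prod.snd e)
      · exact fun e => hi2 (by simpa using congrArg Prod.snd e)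
  rw [himg, card_image_of_injective _ hinj]
  decide

theorem kern_eq_ite (h : IsDistanceScheme δ) [DecidableEq V] {p t : V} (hp : δ p = 1)
    (ht : δ t = 1) : kern δ p t = (if t = p then 36 else 0) - (if t = -p then 36 else 0) -
      (if t ∈ triads δ p then 18 else 0) + (if -t ∈ triads δ p then 18 else 0) := by
  have hpp : p ≠ -p := by
    intro e
    refine h.ne_zero_of_one hp ?_
    linear_combination (norm := (match_scalars <;> decide)) (2 : ZMod 3) • e
  by_cases h1 : t = p
  · subst h1
    have a1 : t ∉ triads δ t := fun h2 => (h.mem_triads_ne h2).2.1 rfl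
    have a2 : -t ∉ triads δ t := fun h2 => (h.mem_triads_ne h2).2.2 rfl
    simp [h.kern_self hp, a1, a2, hpp]
  by_cases h2 : t = -p
  · subst h2
    have a1 : -p ∉ triads δ p := fun h2 => (h.mem_triads_ne h2).2.2 rfl
    have a2 : - -p ∉ triads δ p := fun h2 => (h.mem_triads_ne h2).2.1 (neg_neg p)
    rw [h.kern_comm, h.kern_neg_left, h.kern_self hp, if_neg a1, if_neg a2, if_neg h1, if_pos rfl]
    decide
  simp only [h1, h2, kern, mem_triads, h.neg, ht, sub_neg_eq_add, ← sub_eq_add_neg]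
  have h3 : p ≠ -t := fun e => h2 (by rw [e, neg_neg])
  rcases h.sub_eq_one_or_two hp ht (Ne.symm h1) with h4 | h4 <;>
  rcases h.add_eq_one_or_two hp ht h3 with h5 | h5 <;> rw [h4, h5] <;> decide

/-- Opposite elements of the connection set contribute equally, so the terms at `±p` and at the
triads and their negatives are doubled. -/
theorem sum_sphere_kern_mul_kern (h : IsDistanceScheme δ) {p : V} (hp : δ p = 1) (q : V) :
    ∑ t with δ t = 1, kern δ p t * kern δ t q =
      72 * kern δ p q - 36 * ∑ s ∈ triads δ p, kern δ s q := by
  classical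
  have hT : ∀ t ∈ triads δ p, δ t = 1 := fun t ht => (mem_triads.1 ht).1
  have e1 : ∑ t with δ t = 1, (if t ∈ triads δ p then 18 else 0) * kern δ t q =
      18 * ∑ s ∈ triads δ p, kern δ s q := by
    simp only [ite_mul, zero_mul]
    rw [← sum_filter, mul_sum]
    refine sum_congr ?_ fun _ _ => rfl
    ext t
    simpa using hT t
  have e2 : ∑ t with δ t = 1, (if -t ∈ triads δ p then 18 else 0) * kern δ t q =
      -(18 * ∑ s ∈ triads δ p, kern δ s q) := by
    rw [← e1, ← sum_neg_distrib]
    refine sum_nbij' (fun t => -t) (fun t => -t) ?_ ?_ ?_ ?_ ?_ <;>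
      simp [h.neg, h.kern_neg_left]
  have e3 : ∀ r, δ r = 1 → ∑ t with δ t = 1, (if t = r then 36 else 0) * kern δ t q =
      36 * kern δ r q := by
    intro r hr
    simp [ite_mul, hr]
  rw [sum_congr rfl fun t ht => by rw [h.kern_eq_ite hp (mem_filter.1 ht).2]]
  simp only [add_mul, sub_mul, sum_add_distrib, sum_sub_distrib]
  rw [e1, e2, e3 p hp, e3 (-p) (by rwa [h.neg]), h.kern_neg_left]
  ring

/-- Not every element of the connection set lies in a plane of connection-set elements: otherwise
the antisymmetrised kernel would be nilpotent modulo `5`, with nonzero trace. -/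
theorem exists_tetrads_eq_empty (h : IsDistanceScheme δ) : ∃ p, δ p = 1 ∧ tetrads δ p = ∅ := by
  classical
  by_contra! hcon
  let K : Matrix {s : V // δ s = 1} {s : V // δ s = 1} (ZMod 5) :=
    fun s t => ((kern δ s.1 t.1 : ℤ) : ZMod 5)
  have hK : K ^ 2 = 0 := by
    ext p q
    rw [sq, Matrix.mul_apply, Matrix.zero_apply]
    have h1 := h.kern_relation p.2 q.1
    have h2 := h.card_triads_add_card_tetrads p.2
    rw [h.card_tetrads p.2 (hcon p.1 p.2)] at h2
    have h3 : #(triads δ p.1) = 6 := by omega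
    have h4 := h.sum_sphere_kern_mul_kern p.2 q.1
    rw [← sum_subtype_eq_sum_filter, subtype_univ] at h4
    have h5 : ∑ j, K p j * K j q = ((∑ x : {s : V // δ s = 1},
        kern δ p.1 x.1 * kern δ x.1 q.1 : ℤ) : ZMod 5) := by
      push_cast
      rfl
    rw [h5, h4]
    rw [h3] at h1
    -- With 6 triads, `kern_relation` turns the sum into `-3 kern`, and 72 + 108 = 180 = 5·36.
    have h6 : 72 * kern δ p.1 q.1 - 36 * ∑ s ∈ triads δ p.1, kern δ s q.1 =
        5 * (36 * kern δ p.1 q.1) := by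
      push_cast at h1
      linarith
    rw [h6, Int.cast_mul]
    exact zero_mul _
  have h1 := Matrix.isNilpotent_trace_of_isNilpotent ⟨2, hK⟩
  -- The trace is 36·56 = 2016, congruent to 1 modulo 5.
  have h2 : K.trace = 1 := by
    have h3 : ∀ s : {s : V // δ s = 1}, K.diag s = 36 := by
      intro s
      rw [Matrix.diag_apply]
      simp only [K, h.kern_self s.2]
      rfl
    rw [Matrix.trace, sum_congr rfl fun s _ => h3 s, sum_const, card_univ, Fintype.card_subtype,
      h.card_sphere]
    decide
  rw [h2] at h1
  obtain ⟨n, hn⟩ := h1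
  rw [one_pow] at hn
  exact absurd hn (by decide)

/-! ### Hyperplane sections of the connection set. -/

theorem exists_sub_eq (h : IsDistanceScheme δ) (x : V) (j : Fin 4)
    (hj : intersectionMatrix (δ x) j ≠ 0) : ∃ s, δ s = 1 ∧ δ (x - s) = j := by
  rw [← h.card, card_ne_zero] at hj
  obtain ⟨s, hs⟩ := hj
  exact ⟨s, (mem_filter.1 hs).2⟩

/-- The connection set spans `V`, because the graph is connected. -/
theorem functional_eq_zero (h : IsDistanceScheme δ) {y : V →ₗ[ZMod 3] ZMod 3}
    (hy : ∀ s, δ s = 1 → y s = 0) : y = 0 := by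
  have h2 : ∀ x, δ x = 2 → y x = 0 := by
    intro x hx
    obtain ⟨s, hs, hs'⟩ := h.exists_sub_eq x 1 (by rw [hx]; decide)
    rw [← sub_add_cancel x s, map_add, hy _ hs', hy _ hs, add_zero]
  have h3 : ∀ x, δ x = 3 → y x = 0 := by
    intro x hx
    obtain ⟨s, hs, hs'⟩ := h.exists_sub_eq x 2 (by rw [hx]; decide)
    rw [← sub_add_cancel x s, map_add, h2 _ hs', hy _ hs, add_zero]
  ext x
  have : ∀ i : Fin 4, i = 0 ∨ i = 1 ∨ i = 2 ∨ i = 3 := by decide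
  rcases this (δ x) with hx | hx | hx | hx
  · rw [(h.eq_zero_iff x).1 hx, map_zero, map_zero]
  · exact hy x hx
  · exact h2 x hx
  · exact h3 x hx

/-- The number of elements of the connection set in a hyperplane. -/
theorem card_ker (h : IsDistanceScheme δ) {y : V →ₗ[ZMod 3] ZMod 3} (hy : y ≠ 0) :
    #{s | δ s = 1 ∧ y s = 0} = 14 ∨ #{s | δ s = 1 ∧ y s = 0} = 20 ∨
      #{s | δ s = 1 ∧ y s = 0} = 32 := by
  have hneg : #{s | δ s = 1 ∧ y s = -1} = #{s | δ s = 1 ∧ y s = 1} := by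
    refine card_nbij' (fun s => -s) (fun s => -s) ?_ ?_ (fun _ _ => neg_neg _)
      (fun _ _ => neg_neg _) <;> intro s hs <;> simpa [h.neg, neg_eq_iff_eq_neg] using hs
  have hsum : #{s | δ s = 1 ∧ y s = 0} + #{s | δ s = 1 ∧ y s = 1} + #{s | δ s = 1 ∧ y s = -1}
      = 56 := by
    rw [← h.card_sphere, card_eq_sum_card_fiberwise (s := univ.filter fun s => δ s = 1)
      (f := y) (t := {0, 1, -1})]
    · rw [sum_insert (by decide), sum_insert (by decide), sum_singleton, filter_filter,
        filter_filter, filter_filter, add_assoc]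
    · intro s _
      rcases zmod_three_cases (y s) with e | e | e <;> simp [e]
  have hadj : ∀ x, adj δ 1 (fun z => if y z = 0 then 2 else -1) x =
      3 * #{s | δ s = 1 ∧ y s = y x} - 56 := by
    intro x
    have e : ∀ z, (if y (x - z) = 0 then 2 else -1 : ℤ) = 3 * (if y z = y x then 1 else 0) - 1 := by
      intro z
      simp only [map_sub, sub_eq_zero, eq_comm (a := y x)]
      split_ifs <;> rfl
    simp only [adj, e, sum_sub_distrib, ← mul_sum, sum_boole, filter_filter, sum_const,
      h.card_sphere]
    rfl
  have heig : ∀ x, adj δ 1 (fun z => if y z = 0 then 2 else -1) x =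
      (56 - 3 * #{s | δ s = 1 ∧ y s = 1}) * (if y x = 0 then 2 else -1) := by
    intro x
    rw [hadj]
    rcases zmod_three_cases (y x) with e | e | e
    · rw [e, if_pos rfl]; omega
    · rw [e, if_neg (by decide)]; omega
    · rw [e, if_neg (by decide)]; omega
  have := h.eigenvalue_mem heig (x := 0) (by simp)
  have hne : #{s | δ s = 1 ∧ y s = 1} ≠ 0 := by
    intro h0
    have h1 := hneg.trans h0
    rw [card_eq_zero, filter_eq_empty_iff] at h0 h1
    refine hy (h.functional_eq_zero fun s hs => ?_)
    rcases zmod_three_cases (y s) with e | e | e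
    · exact e
    · exact absurd ⟨hs, e⟩ (h0 (mem_univ s))
    · exact absurd ⟨hs, e⟩ (h1 (mem_univ s))
  -- If `N` elements take the value 1, the eigenvalue is `56 - 3N` and the kernel has `56 - 2N`
  -- elements; eigenvalues 20, 2, -7 give 32, 20, 14.
  omega

theorem exists_functional (h : IsDistanceScheme δ) (B : Finset V) (hB : #B ≤ 5) :
    ∃ y : V →ₗ[ZMod 3] ZMod 3, y ≠ 0 ∧ ∀ b ∈ B, y b = 0 := by
  have hfin : Module.finrank (ZMod 3) V = 6 := by
    have h1 := Module.card_eq_pow_finrank (K := ZMod 3) (V := V)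
    rw [h.card_eq, ZMod.card] at h1
    exact Nat.pow_right_injective (a := 3) (by decide) (h1.symm.trans rfl : 3 ^ _ = 3 ^ 6)
  have hlt : Submodule.span (ZMod 3) (B : Set V) < ⊤ := by
    rw [lt_top_iff_ne_top]
    intro htop
    have h2 := finrank_span_finset_le_card (R := ZMod 3) B
    rw [Set.finrank, htop, finrank_top, hfin] at h2
    omega
  obtain ⟨y, hy, hle⟩ := Submodule.exists_le_ker_of_lt_top _ hlt
  exact ⟨y, hy, fun b hb => hle (Submodule.subset_span hb)⟩

end IsDistanceScheme

/-! ### Counting triads and their differences in a hyperplane through `p`. -/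

/-- The elements of the connection set in the kernel of `y` that are not on a line joining `p` to
one of its triads. -/
def outer [DecidableEq V] (δ : V → Fin 4) (p : V) (y : V →ₗ[ZMod 3] ZMod 3) : Finset V :=
  {s | δ s = 1 ∧ y s = 0 ∧ s ≠ p ∧ s ≠ -p ∧ s ∉ triads δ p ∧ -s ∉ triads δ p}

/-- The pairs of triads of `p` in `R` that differ by an element of the connection set. -/
def adjPairs (δ : V → Fin 4) (R : Finset V) : Finset (V × V) :=
  (R ×ˢ R).filter fun a => δ (a.1 - a.2) = 1

namespace IsDistanceScheme

theorem card_ker_eq (h : IsDistanceScheme δ) [DecidableEq V] {p : V} (hp : δ p = 1)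
    {y : V →ₗ[ZMod 3] ZMod 3} (hy : y p = 0) :
    #{s | δ s = 1 ∧ y s = 0} = 2 + 2 * #{t ∈ triads δ p | y t = 0} + #(outer δ p y) := by
  have hpp : p ≠ -p := by
    intro e
    refine h.ne_zero_of_one hp ?_
    linear_combination (norm := (match_scalars <;> decide)) (2 : ZMod 3) • e
  have h1 : univ.filter (fun s => δ s = 1 ∧ y s = 0) = (({p, -p} ∪ {t ∈ triads δ p | y t = 0}) ∪
      {t ∈ triads δ p | y t = 0}.image (fun t => -t)) ∪ outer δ p y := by
    ext s
    simp only [mem_union, mem_insert, mem_singleton, mem_filter, mem_image, outer, mem_univ,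
      true_and]
    constructor
    · rintro ⟨a, b⟩
      by_cases c1 : s = p
      · exact Or.inl (Or.inl (Or.inl (Or.inl c1)))
      by_cases c2 : s = -p
      · exact Or.inl (Or.inl (Or.inl (Or.inr c2)))
      by_cases c3 : s ∈ triads δ p
      · exact Or.inl (Or.inl (Or.inr ⟨c3, b⟩))
      by_cases c4 : -s ∈ triads δ p
      · exact Or.inl (Or.inr ⟨-s, ⟨c4, by rw [map_neg, b, neg_zero]⟩, neg_neg s⟩)
      · exact Or.inr ⟨a, b, c1, c2, c3, c4⟩
    · rintro ((((rfl | rfl) | ⟨a, b⟩) | ⟨t, ⟨a, b⟩, rfl⟩) | ⟨a, b, -⟩)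
      · exact ⟨hp, hy⟩
      · exact ⟨by rwa [h.neg], by rw [map_neg, hy, neg_zero]⟩
      · exact ⟨(mem_triads.1 a).1, b⟩
      · exact ⟨by rw [h.neg, (mem_triads.1 a).1], by rw [map_neg, b, neg_zero]⟩
      · exact ⟨a, b⟩
  rw [h1, card_union_of_disjoint, card_union_of_disjoint, card_union_of_disjoint, card_pair hpp,
    card_image_of_injective _ neg_injective]
  · ring
  · rw [disjoint_left]
    intro s hs hs'
    have h2 := h.mem_triads_ne (mem_filter.1 hs').1
    simp only [mem_insert, mem_singleton] at hs
    rcases hs with hs | hs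
    · exact h2.2.1 hs
    · exact h2.2.2 hs
  · rw [disjoint_left]
    intro s hs hs'
    obtain ⟨t, ht, rfl⟩ := mem_image.1 hs'
    have h2 := h.mem_triads_ne (mem_filter.1 ht).1
    simp only [mem_union, mem_insert, mem_singleton, mem_filter] at hs
    rcases hs with (hs | hs) | hs
    · exact h2.2.2 (neg_eq_iff_eq_neg.1 hs)
    · exact h2.2.1 (neg_injective hs)
    · exact neg_notMem_triads (mem_filter.1 ht).1 hs.1
  · rw [disjoint_left]
    intro s hs hs'
    simp only [outer, mem_filter_univ] at hs'
    obtain ⟨-, -, c1, c2, c3, c4⟩ := hs'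
    simp only [mem_union, mem_insert, mem_singleton, mem_filter, mem_image] at hs
    rcases hs with ((hs | hs) | hs) | ⟨t, ht, rfl⟩
    · exact c1 hs
    · exact c2 hs
    · exact c3 hs.1
    · exact c4 ((neg_neg t).symm ▸ ht.1)

theorem ne_of_sub_eq_one (h : IsDistanceScheme δ) {p a b : V} (ha : a ∈ triads δ p)
    (hab : δ (a - b) = 1) : b ≠ a ∧ b ≠ -p - a := by
  refine ⟨fun e => h.ne_zero_of_one hab (by rw [e, sub_self]), fun e => ?_⟩
  have e1 : a - b = p - a := by
    linear_combination (norm := (match_scalars <;> decide)) (-1 : ZMod 3) • e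
  rw [e1, (mem_triads.1 ha).2.2] at hab
  exact absurd hab (by decide)

theorem add_eq_two (h : IsDistanceScheme δ) {p a b : V} (hp : δ p = 1) (ha : a ∈ triads δ p)
    (hb : b ∈ triads δ p) (hab : b ≠ a ∧ b ≠ -p - a) : δ (a + b) = 2 :=
  (h.sub_eq_one_or_sub_mate_eq_one hp ha hb hab.1 hab.2).2

theorem add_notMem_triads (h : IsDistanceScheme δ) {p a b c : V} (hp : δ p = 1)
    (ha : a ∈ triads δ p) (hb : b ∈ triads δ p) (hc : δ c = 1) (hca : c ≠ -a) (hcp : c ≠ -p) :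
    a + b ≠ c := by
  intro e
  by_cases h1 : b = a
  · subst h1
    exact hca (by rw [← e, add_self_eq_neg])
  by_cases h2 : b = -p - a
  · exact hcp (by rw [← e, h2]; abel)
  have := h.add_eq_two hp ha hb ⟨h1, h2⟩
  rw [e, hc] at this
  exact absurd this (by decide)

/-- If `a - b` lay on one of the lines through `p`, then `a` or `b` would be a sum contradicting the
dichotomy for triads. -/
theorem sub_mem_outer (h : IsDistanceScheme δ) [DecidableEq V] {p a b : V} (hp : δ p = 1)
    {y : V →ₗ[ZMod 3] ZMod 3} (ha : a ∈ triads δ p) (hb : b ∈ triads δ p)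
    (hab : δ (a - b) = 1) (hy : y a = y b) : a - b ∈ outer δ p y := by
  have key : ∀ a b, a ∈ triads δ p → b ∈ triads δ p → a - b ≠ p := by
    intro a b ha hb e
    refine neg_notMem_triads (h.mate_mem_triads hb) ?_
    rwa [show -(-p - b) = a by rw [← e]; abel]
  have key' : ∀ a b, a ∈ triads δ p → b ∈ triads δ p → a - b ∉ triads δ p := by
    intro a b ha hb e
    refine h.add_notMem_triads hp hb e (mem_triads.1 ha).1 ?_ (h.mem_triads_ne ha).2.2
      (add_sub_cancel b a)
    intro e'
    exact neg_notMem_triads hb (e' ▸ ha)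
  rw [outer, mem_filter_univ]
  refine ⟨hab, by rw [map_sub, hy, sub_self], key a b ha hb, fun e => key b a hb ha ?_,
    key' a b ha hb, fun e => key' b a hb ha ?_⟩
  · rw [← neg_sub, e, neg_neg]
  · rwa [neg_sub] at e

/-- In a set of triads that is closed under taking mates, half of the elements on other lines
are adjacent to a given one. -/
theorem two_mul_card_adj (h : IsDistanceScheme δ) [DecidableEq V] {p s : V} (hp : δ p = 1)
    {R : Finset V} (hR : R ⊆ triads δ p) (hR' : ∀ t ∈ R, -p - t ∈ R) (hs : s ∈ R) :
    2 * #{t ∈ R | δ (s - t) = 1} + 2 = #R := by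
  have h1 : #{t ∈ R | δ (s - t) = 1} = #{t ∈ R | δ (s - (-p - t)) = 1} := by
    refine card_nbij' (fun t => -p - t) (fun t => -p - t) ?_ ?_ (fun t _ => mate_mate p t)
      (fun t _ => mate_mate p t)
    · intro t ht
      obtain ⟨ht, ht'⟩ := mem_filter.1 ht
      exact mem_filter.2 ⟨hR' t ht, by rwa [mate_mate]⟩
    · intro t ht
      obtain ⟨ht, ht'⟩ := mem_filter.1 ht
      exact mem_filter.2 ⟨hR' t ht, ht'⟩
  have h2 : R = ({s, -p - s} ∪ {t ∈ R | δ (s - t) = 1}) ∪ {t ∈ R | δ (s - (-p - t)) = 1} := by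
    ext t
    simp only [mem_union, mem_insert, mem_singleton, mem_filter]
    constructor
    · intro ht
      by_cases c1 : t = s
      · exact Or.inl (Or.inl (Or.inl c1))
      by_cases c2 : t = -p - s
      · exact Or.inl (Or.inl (Or.inr c2))
      rcases (h.sub_eq_one_or_sub_mate_eq_one hp (hR hs) (hR ht) c1 c2).1 with c | c
      · exact Or.inl (Or.inr ⟨ht, c.1⟩)
      · exact Or.inr ⟨ht, c.2⟩
    · rintro (((rfl | rfl) | ht) | ht)
      · exact hs
      · exact hR' s hs
      · exact ht.1
      · exact ht.1
  have h3 := congrArg Finset.card h2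
  rw [card_union_of_disjoint, card_union_of_disjoint, card_pair (h.mate_ne (hR hs)).symm,
    ← h1] at h3
  · omega
  · rw [disjoint_left]
    intro t ht ht'
    have h4 := h.ne_of_sub_eq_one (hR hs) (mem_filter.1 ht').2
    simp only [mem_insert, mem_singleton] at ht
    rcases ht with ht | ht
    · exact h4.1 ht
    · exact h4.2 ht
  · rw [disjoint_left]
    intro t ht ht'
    obtain ⟨t1, t2⟩ := mem_filter.1 ht'
    rcases mem_union.1 ht with ht | ht
    · have h4 := h.ne_of_sub_eq_one (hR hs) t2
      simp only [mem_insert, mem_singleton] at ht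
      rcases ht with ht | ht
      · exact h4.2 (by rw [ht])
      · exact h4.1 (by rw [ht, mate_mate])
    · exact h.not_sub_and_sub_mate hp (hR hs) (hR t1) (mem_filter.1 ht).2 t2

theorem two_mul_card_adjPairs (h : IsDistanceScheme δ) [DecidableEq V] {p : V} (hp : δ p = 1)
    {R : Finset V} (hR : R ⊆ triads δ p) (hR' : ∀ t ∈ R, -p - t ∈ R) :
    2 * #(adjPairs δ R) + 2 * #R = #R * #R := by
  have h1 : #(adjPairs δ R) = ∑ s ∈ R, #{t ∈ R | δ (s - t) = 1} := by
    rw [adjPairs, card_filter, sum_product]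
    exact sum_congr rfl fun s _ => (card_filter _ _).symm
  rw [h1, mul_sum, mul_comm 2 #R, ← smul_eq_mul #R 2, ← sum_const, ← sum_add_distrib,
    sum_congr rfl fun s hs => h.two_mul_card_adj hp hR hR' hs, sum_const, smul_eq_mul]

end IsDistanceScheme

/-! ### Coincidences between differences of adjacent triads. -/

/-- The triads `a` and `b` of `p` are on different lines through `p`. -/
abbrev Skew (p a b : V) : Prop := b ≠ a ∧ b ≠ -p - a

theorem Skew.ne_mate {p a b : V} (h : Skew p a b) : b ≠ -p - a := h.2

theorem Skew.symm {p a b : V} (h : Skew p a b) : Skew p b a :=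
  ⟨h.1.symm, fun e => h.2 (by rw [e, sub_sub_cancel])⟩

theorem Skew.mate {p a b : V} (h : Skew p a b) : Skew p a (-p - b) :=
  ⟨fun e => h.2 (by rw [← e, sub_sub_cancel]), fun e => h.1 (sub_right_injective e)⟩

namespace IsDistanceScheme

theorem skew_of_sub_eq_sub (h : IsDistanceScheme δ) {p s t u v : V} (hp : δ p = 1)
    (hs : s ∈ triads δ p) (ht : t ∈ triads δ p) (hv : v ∈ triads δ p)
    (hst : δ (s - t) = 1) (e : s - t = u - v) (h1 : ¬(u = s ∧ v = t))
    (h2 : ¬(u = -p - t ∧ v = -p - s)) : Skew p s u ∧ Skew p t u := by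
  have hadd := h.add_eq_two hp hs ht (h.ne_of_sub_eq_one hs hst)
  refine ⟨⟨fun c => h1 ⟨c, ?_⟩, fun c => ?_⟩, ⟨fun c => ?_, fun c => h2 ⟨c, ?_⟩⟩⟩
  · linear_combination (norm := (match_scalars <;> decide)) (1 : ZMod 3) • c + (1 : ZMod 3) • e
  · have e1 : p + v = s + t := by
      linear_combination (norm := (match_scalars <;> decide)) (1 : ZMod 3) • c + (1 : ZMod 3) • e
    rw [← e1, (mem_triads.1 hv).2.1] at hadd
    exact absurd hadd (by decide)
  · have e1 : v = -(s + t) := by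
      linear_combination (norm := (match_scalars <;> decide)) (1 : ZMod 3) • c + (1 : ZMod 3) • e
    rw [← h.neg, ← e1, (mem_triads.1 hv).1] at hadd
    exact absurd hadd (by decide)
  · linear_combination (norm := (match_scalars <;> decide)) (1 : ZMod 3) • c + (1 : ZMod 3) • e

/-- If two pairs of triads have the same difference, then they form a closed configuration. -/
theorem sub_eq_one_of_sub_eq_sub (h : IsDistanceScheme δ) {p s t u v : V} (hp : δ p = 1)
    (hs : s ∈ triads δ p) (ht : t ∈ triads δ p) (hu : u ∈ triads δ p) (hv : v ∈ triads δ p)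
    (hst : δ (s - t) = 1) (e : s - t = u - v) (hsu : Skew p s u)
    (hsv : Skew p s v) : δ (u - s) = 1 := by
  have huv : δ (u - v) = 1 := e ▸ hst
  have a1 := h.add_eq_two hp hs ht (h.ne_of_sub_eq_one hs hst)
  have a2 := h.add_eq_two hp hu hv (h.ne_of_sub_eq_one hu huv)
  have a3 := h.add_eq_two hp hs hv hsv
  -- The base point changes: `-s` and `-u` are triads of `s - t = u - v`, so the dichotomy applies
  -- there, and its second alternative would put `s + v` at distance 1 rather than 2.
  have m1 : -s ∈ triads δ (s - t) := by
    rw [mem_triads, h.neg]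
    refine ⟨(mem_triads.1 hs).1, ?_, ?_⟩
    · rw [show s - t + -s = -t by abel, h.neg, (mem_triads.1 ht).1]
    · rw [show s - t - -s = -(s + t) by
        linear_combination (norm := (match_scalars <;> decide)) (0 : ZMod 3) • e, h.neg, a1]
  have m2 : -u ∈ triads δ (s - t) := by
    rw [e, mem_triads, h.neg]
    refine ⟨(mem_triads.1 hu).1, ?_, ?_⟩
    · rw [show u - v + -u = -v by abel, h.neg, (mem_triads.1 hv).1]
    · rw [show u - v - -u = -(u + v) by
        linear_combination (norm := (match_scalars <;> decide)) (0 : ZMod 3) • e, h.neg, a2]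
  have n1 : -u ≠ -s := fun c => hsu.1 (neg_injective c)
  have n2 : -u ≠ -(s - t) - -s := by
    intro c
    have : t = -u := by rw [c]; abel
    exact neg_notMem_triads hu (this ▸ ht)
  rcases (h.sub_eq_one_or_sub_mate_eq_one hst m1 m2 n1 n2).1 with ⟨c, -⟩ | ⟨-, c⟩
  · rwa [show -s - -u = u - s by abel] at c
  · have e2 : -s - (-(s - t) - -u) = -(s + v) := by
      linear_combination (norm := (match_scalars <;> decide)) (1 : ZMod 3) • e
    rw [e2, h.neg, a3] at c
    exact absurd c (by decide)

theorem sub_ne_sub_of_skew (h : IsDistanceScheme δ) {p a b w x : V} (hp : δ p = 1)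
    (ha : a ∈ triads δ p) (hb : b ∈ triads δ p) (hw : w ∈ triads δ p) (hab : δ (a - b) = 1)
    (hwa : Skew p w a) (hwb : Skew p w b) (hx : x = a ∨ x = b) :
    w - x ≠ a - b ∧ w - x ≠ -(a - b) := by
  have hadd := h.add_eq_two hp ha hb (h.ne_of_sub_eq_one ha hab)
  have key : w ≠ -(a + b) := by
    intro e
    rw [← h.neg, ← e, (mem_triads.1 hw).1] at hadd
    exact absurd hadd (by decide)
  rcases hx with rfl | rfl
  · refine ⟨fun e => key ?_, fun e => hwb.1 ?_⟩
    · linear_combination (norm := (match_scalars <;> decide)) (1 : ZMod 3) • e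
    · linear_combination (norm := (match_scalars <;> decide)) (-1 : ZMod 3) • e
  · refine ⟨fun e => hwa.1 ?_, fun e => key ?_⟩
    · linear_combination (norm := (match_scalars <;> decide)) (-1 : ZMod 3) • e
    · linear_combination (norm := (match_scalars <;> decide)) (1 : ZMod 3) • e

theorem two_mul_card_le_card_outer (h : IsDistanceScheme δ) [DecidableEq V] {p : V}
    {y : V →ₗ[ZMod 3] ZMod 3} {P : Finset V} (hP : P ⊆ outer δ p y)
    (hneg : ∀ a ∈ P, ∀ b ∈ P, a ≠ -b) : 2 * #P ≤ #(outer δ p y) := by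
  have h1 : P ∪ P.image (fun a => -a) ⊆ outer δ p y := by
    refine union_subset hP (image_subset_iff.2 fun a ha => ?_)
    have := hP ha
    simp only [outer, mem_filter_univ] at this ⊢
    obtain ⟨a1, a2, a3, a4, a5, a6⟩ := this
    exact ⟨by rwa [h.neg], by rw [map_neg, a2, neg_zero], fun e => a4 (neg_eq_iff_eq_neg.1 e),
      fun e => a3 (neg_injective e), a6, by rwa [neg_neg]⟩
  have h2 : Disjoint P (P.image fun a => -a) := by
    rw [disjoint_left]
    intro a ha ha'
    obtain ⟨b, hb, rfl⟩ := mem_image.1 ha'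
    exact hneg _ ha b hb rfl
  have h3 := card_le_card h1
  rw [card_union_of_disjoint h2, card_image_of_injective _ neg_injective] at h3
  omega

theorem ne_neg_self (h : IsDistanceScheme δ) {x : V} (hx : δ x = 1) : x ≠ -x := by
  intro e
  refine h.ne_zero_of_one hx ?_
  linear_combination (norm := (match_scalars <;> decide)) (2 : ZMod 3) • e

theorem card_union_mates [DecidableEq V] {p : V} {L : Finset V}
    (hL : ∀ a ∈ L, ∀ b ∈ L, b ≠ -p - a) : #(L ∪ L.image fun a => -p - a) = 2 * #L := by
  rw [card_union_of_disjoint, card_image_of_injective _ sub_right_injective, two_mul]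
  rw [disjoint_left]
  intro b hb hb'
  obtain ⟨a, ha, rfl⟩ := mem_image.1 hb'
  exact hL a ha _ hb rfl

/-- Any other coincidence involves four lines through `p` lying in a common 4-space with `p`. A
hyperplane containing it and a fifth line would have more than 32 elements of the connection set. -/
theorem sub_eq_sub_iff (h : IsDistanceScheme δ) {p s t u v : V} (hp : δ p = 1)
    (hT : #(triads δ p) = 12)
    (hs : s ∈ triads δ p) (ht : t ∈ triads δ p) (hu : u ∈ triads δ p) (hv : v ∈ triads δ p)
    (hst : δ (s - t) = 1) (e : s - t = u - v) :
    (u = s ∧ v = t) ∨ (u = -p - t ∧ v = -p - s) := by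
  classical
  by_contra! hcon
  have huv : δ (u - v) = 1 := e ▸ hst
  have hts : δ (t - s) = 1 := by rwa [h.sub_comm]
  have st : Skew p s t := h.ne_of_sub_eq_one hs hst
  have uv : Skew p u v := h.ne_of_sub_eq_one hu huv
  obtain ⟨su, tu⟩ := h.skew_of_sub_eq_sub hp hs ht hv hst e (fun c => hcon.1 c.1 c.2)
    (fun c => hcon.2 c.1 c.2)
  have e' : t - s = v - u := by rw [← neg_sub, e, neg_sub]
  obtain ⟨tv, sv⟩ := h.skew_of_sub_eq_sub hp ht hs hu hts e' (fun c => hcon.1 c.2 c.1)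
    (fun c => hcon.2 c.2 c.1)
  have hus := h.sub_eq_one_of_sub_eq_sub hp hs ht hu hv hst e su sv
  have e2 : u - s = v - t := by
    linear_combination (norm := (match_scalars <;> decide)) (-1 : ZMod 3) • e
  -- The four lines carry at most 8 of the 12 triads.
  obtain ⟨w, hw, hw'⟩ : ∃ w ∈ triads δ p, w ∉ ({s, t, u, v, -p - s, -p - t, -p - u, -p - v} :
      Finset V) := by
    refine exists_mem_notMem_of_card_lt_card (lt_of_le_of_lt ((card_insert_le _ _).trans
      (Nat.succ_le_succ ((card_insert_le _ _).trans (Nat.succ_le_succ card_le_six)))) ?_)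
    rw [hT]
    decide
  simp only [mem_insert, mem_singleton, not_or] at hw'
  obtain ⟨w1, w2, w3, w4, w5, w6, w7, w8⟩ := hw'
  have sw : Skew p w s := Skew.symm ⟨w1, w5⟩
  have tw : Skew p w t := Skew.symm ⟨w2, w6⟩
  have uw : Skew p w u := Skew.symm ⟨w3, w7⟩
  have vw : Skew p w v := Skew.symm ⟨w4, w8⟩
  -- Five vectors suffice: `v = u - s + t` vanishes automatically.
  obtain ⟨y, hy, hB⟩ := h.exists_functional {p, s, t, u, w} card_le_five
  have yp : y p = 0 := hB p (by simp)
  have ys : y s = 0 := hB s (by simp)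
  have yt : y t = 0 := hB t (by simp)
  have yu : y u = 0 := hB u (by simp)
  have yw : y w = 0 := hB w (by simp)
  have yv : y v = 0 := by
    rw [show v = u - s + t by rw [e2]; abel, map_add, map_sub, yu, ys, yt, sub_self, add_zero]
  have ymate : ∀ a, y a = 0 → y (-p - a) = 0 := by
    intro a ha
    rw [map_sub, map_neg, yp, ha, neg_zero, sub_zero]
  let L : Finset V := {s, t, u, v, w}
  let R : Finset V := L ∪ L.image fun a => -p - a
  have hLT : ∀ a ∈ L, a ∈ triads δ p ∧ y a = 0 := by
    intro a ha
    simp only [L, mem_insert, mem_singleton] at ha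
    rcases ha with rfl | rfl | rfl | rfl | rfl
    exacts [⟨hs, ys⟩, ⟨ht, yt⟩, ⟨hu, yu⟩, ⟨hv, yv⟩, ⟨hw, yw⟩]
  have hLcard : #L = 5 := by
    simp only [L]
    rw [card_insert_of_notMem, card_insert_of_notMem, card_insert_of_notMem, card_pair]
    · exact vw.1
    · simp only [mem_insert, mem_singleton, not_or]
      exact ⟨uv.1.symm, uw.1⟩
    · simp only [mem_insert, mem_singleton, not_or]
      exact ⟨tu.1.symm, tv.1.symm, tw.1⟩
    · simp only [mem_insert, mem_singleton, not_or]
      exact ⟨st.1.symm, su.1.symm, sv.1.symm, sw.1⟩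
  have hLmate : ∀ a ∈ L, ∀ b ∈ L, b ≠ -p - a := by
    intro a ha b hb
    by_cases hab : b = a
    · rw [hab]
      exact (h.mate_ne (hLT a ha).1).symm
    simp only [L, mem_insert, mem_singleton] at ha hb
    rcases ha with rfl | rfl | rfl | rfl | rfl <;> rcases hb with rfl | rfl | rfl | rfl | rfl <;>
    first
    | exact absurd rfl hab
    | (refine Skew.ne_mate ?_; assumption)
    | (refine (Skew.symm (p := p) ?_).2; assumption)
  have hRcard : #R = 10 := by rw [card_union_mates hLmate, hLcard]
  have hRmem : ∀ a ∈ R, a ∈ L ∨ -p - a ∈ L := by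
    intro a ha
    rcases mem_union.1 ha with ha | ha
    · exact Or.inl ha
    · obtain ⟨b, hb, rfl⟩ := mem_image.1 ha
      exact Or.inr (by rwa [mate_mate])
  have hRT : ∀ a ∈ R, a ∈ triads δ p ∧ y a = 0 := by
    intro a ha
    rcases hRmem a ha with ha | ha
    · exact hLT a ha
    · have := hLT _ ha
      rw [← mate_mate p a]
      exact ⟨h.mate_mem_triads this.1, ymate _ this.2⟩
  have hRmate : ∀ a ∈ R, -p - a ∈ R := by
    intro a ha
    rcases mem_union.1 ha with ha | ha
    · exact mem_union_right _ (mem_image_of_mem _ ha)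
    · obtain ⟨b, hb, rfl⟩ := mem_image.1 ha
      exact mem_union_left _ (by rwa [mate_mate])
  have hwR : w ∈ R := mem_union_left _ (by simp [L])
  let X : Finset V := {x ∈ R | δ (w - x) = 1}
  have hX : #X = 4 := by
    have := h.two_mul_card_adj hp (fun a ha => (hRT a ha).1) hRmate hwR
    simp only [X]
    omega
  have hXmem : ∀ x ∈ X, x ∈ triads δ p ∧ y x = 0 ∧ δ (w - x) = 1 ∧
      (x = s ∨ x = t ∨ x = u ∨ x = v ∨ x = -p - s ∨ x = -p - t ∨ x = -p - u ∨ x = -p - v) := by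
    intro x hx
    obtain ⟨x1, x2⟩ := mem_filter.1 hx
    obtain ⟨x3, x4⟩ := hRT x x1
    refine ⟨x3, x4, x2, ?_⟩
    have x5 := h.ne_of_sub_eq_one hw x2
    have x6 := hRmem x x1
    simp only [L, mem_insert, mem_singleton] at x6
    have inv : ∀ c, -p - x = c → x = -p - c := fun c hc => by rw [← hc, mate_mate]
    rcases x6 with (c | c | c | c | c) | (c | c | c | c | c)
    · simp [c]
    · simp [c]
    · simp [c]
    · simp [c]
    · exact absurd c x5.1
    · simp [inv _ c]
    · simp [inv _ c]
    · simp [inv _ c]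
    · simp [inv _ c]
    · exact absurd (inv _ c) x5.2
  have hs' := h.mate_mem_triads hs
  have ht' := h.mate_mem_triads ht
  have hu' := h.mate_mem_triads hu
  have hv' := h.mate_mem_triads hv
  have hvt : δ (v - t) = 1 := e2 ▸ hus
  have hX1 : ∀ x ∈ X, w - x ≠ s - t ∧ w - x ≠ -(s - t) := by
    intro x hx
    have e3 : s - t = (-p - t) - (-p - s) := by abel
    have e4 : s - t = (-p - v) - (-p - u) := by rw [e]; abel
    rcases (hXmem x hx).2.2.2 with c | c | c | c | c | c | c | c
    · exact h.sub_ne_sub_of_skew hp hs ht hw hst sw tw (Or.inl c)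
    · exact h.sub_ne_sub_of_skew hp hs ht hw hst sw tw (Or.inr c)
    · rw [e]; exact h.sub_ne_sub_of_skew hp hu hv hw huv uw vw (Or.inl c)
    · rw [e]; exact h.sub_ne_sub_of_skew hp hu hv hw huv uw vw (Or.inr c)
    · rw [e3]; exact h.sub_ne_sub_of_skew hp ht' hs' hw (e3 ▸ hst) tw.mate sw.mate (Or.inr c)
    · rw [e3]; exact h.sub_ne_sub_of_skew hp ht' hs' hw (e3 ▸ hst) tw.mate sw.mate (Or.inl c)
    · rw [e4]; exact h.sub_ne_sub_of_skew hp hv' hu' hw (e4 ▸ hst) vw.mate uw.mate (Or.inr c)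
    · rw [e4]; exact h.sub_ne_sub_of_skew hp hv' hu' hw (e4 ▸ hst) vw.mate uw.mate (Or.inl c)
  have hX2 : ∀ x ∈ X, w - x ≠ u - s ∧ w - x ≠ -(u - s) := by
    intro x hx
    have e3 : u - s = (-p - s) - (-p - u) := by abel
    have e4 : u - s = (-p - t) - (-p - v) := by rw [e2]; abel
    rcases (hXmem x hx).2.2.2 with c | c | c | c | c | c | c | c
    · exact h.sub_ne_sub_of_skew hp hu hs hw hus uw sw (Or.inr c)
    · rw [e2]; exact h.sub_ne_sub_of_skew hp hv ht hw hvt vw tw (Or.inr c)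
    · exact h.sub_ne_sub_of_skew hp hu hs hw hus uw sw (Or.inl c)
    · rw [e2]; exact h.sub_ne_sub_of_skew hp hv ht hw hvt vw tw (Or.inl c)
    · rw [e3]; exact h.sub_ne_sub_of_skew hp hs' hu' hw (e3 ▸ hus) sw.mate uw.mate (Or.inl c)
    · rw [e4]; exact h.sub_ne_sub_of_skew hp ht' hv' hw (e4 ▸ hus) tw.mate vw.mate (Or.inl c)
    · rw [e3]; exact h.sub_ne_sub_of_skew hp hs' hu' hw (e3 ▸ hus) sw.mate uw.mate (Or.inr c)
    · rw [e4]; exact h.sub_ne_sub_of_skew hp ht' hv' hw (e4 ▸ hus) tw.mate vw.mate (Or.inr c)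
  have hX3 : ∀ x ∈ X, ∀ z ∈ X, w - x ≠ -(w - z) := by
    intro x hx z hz c
    obtain ⟨x1, -, x2, -⟩ := hXmem x hx
    obtain ⟨z1, -, z2, -⟩ := hXmem z hz
    refine h.add_notMem_triads hp x1 z1 (c := -w) (by rw [h.neg, (mem_triads.1 hw).1]) ?_ ?_ ?_
    · exact fun c => (h.ne_of_sub_eq_one hw x2).1 (neg_injective c).symm
    · exact fun c => (h.mem_triads_ne hw).2.1 (neg_injective c)
    · linear_combination (norm := (match_scalars <;> decide)) (-1 : ZMod 3) • c
  have e12 : s - t ≠ u - s := by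
    intro c
    refine h.add_notMem_triads hp ht hu (c := -s) (by rw [h.neg, (mem_triads.1 hs).1]) ?_ ?_ ?_
    · exact fun c => st.1 (neg_injective c).symm
    · exact fun c => (h.mem_triads_ne hs).2.1 (neg_injective c)
    · linear_combination (norm := (match_scalars <;> decide)) (-1 : ZMod 3) • c
  have e12' : s - t ≠ -(u - s) := by
    intro c
    refine tu.1 ?_
    linear_combination (norm := (match_scalars <;> decide)) (1 : ZMod 3) • c
  let P : Finset V := insert (s - t) (insert (u - s) (X.image fun x => w - x))
  have hPcard : #P = 6 := by
    simp only [P]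
    rw [card_insert_of_notMem, card_insert_of_notMem,
      card_image_of_injective _ sub_right_injective, hX]
    · intro c
      obtain ⟨x, hx, c⟩ := mem_image.1 c
      exact (hX2 x hx).1 c
    · intro c
      rcases mem_insert.1 c with c | c
      · exact e12 c
      · obtain ⟨x, hx, c⟩ := mem_image.1 c
        exact (hX1 x hx).1 c
  have hPsub : P ⊆ outer δ p y := by
    intro a ha
    simp only [P, mem_insert, mem_image] at ha
    rcases ha with rfl | rfl | ⟨x, hx, rfl⟩
    · exact h.sub_mem_outer hp hs ht hst (by rw [ys, yt])
    · exact h.sub_mem_outer hp hu hs hus (by rw [yu, ys])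
    · obtain ⟨x1, x2, x3, -⟩ := hXmem x hx
      exact h.sub_mem_outer hp hw x1 x3 (by rw [yw, x2])
  have hPneg : ∀ a ∈ P, ∀ b ∈ P, a ≠ -b := by
    intro a ha b hb
    simp only [P, mem_insert, mem_image] at ha hb
    rcases ha with rfl | rfl | ⟨x, hx, rfl⟩ <;> rcases hb with rfl | rfl | ⟨z, hz, rfl⟩
    · exact h.ne_neg_self hst
    · exact e12'
    · exact fun c => (hX1 z hz).2 (neg_eq_iff_eq_neg.1 c.symm)
    · exact fun c => e12' (neg_eq_iff_eq_neg.1 c.symm)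
    · exact h.ne_neg_self hus
    · exact fun c => (hX2 z hz).2 (neg_eq_iff_eq_neg.1 c.symm)
    · exact (hX1 x hx).2
    · exact (hX2 x hx).2
    · exact hX3 x hx z hz
  have k1 := h.two_mul_card_le_card_outer hPsub hPneg
  have k2 := h.card_ker_eq hp yp
  have k3 : #R ≤ #{t ∈ triads δ p | y t = 0} :=
    card_le_card fun a ha => mem_filter.2 (hRT a ha)
  have k4 := h.card_ker hy
  -- The hyperplane has at least 2 + 2·10 + 2·6 = 34 elements, above the maximum 32.
  omega

end IsDistanceScheme

/-! ### Exact hyperplane counts in terms of triads. -/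

theorem mem_adjPairs {R : Finset V} {a : V × V} :
    a ∈ adjPairs δ R ↔ (a.1 ∈ R ∧ a.2 ∈ R) ∧ δ (a.1 - a.2) = 1 := by
  rw [adjPairs, mem_filter, mem_product]

namespace IsDistanceScheme

/-- Each difference comes from exactly two ordered pairs, `(a, b)` and the swapped pair of mates. -/
theorem card_adjPairs_filter (h : IsDistanceScheme δ) [DecidableEq V] {p : V} (hp : δ p = 1)
    (hT : #(triads δ p) = 12) (y : V →ₗ[ZMod 3] ZMod 3) :
    #{a ∈ adjPairs δ (triads δ p) | y a.1 = y a.2} =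
      2 * #({a ∈ adjPairs δ (triads δ p) | y a.1 = y a.2}.image fun a => a.1 - a.2) := by
  rw [card_eq_sum_card_image (fun a : V × V => a.1 - a.2), mul_comm, ← smul_eq_mul, ← sum_const]
  refine sum_congr rfl fun e he => ?_
  obtain ⟨⟨a, b⟩, hab, rfl⟩ := mem_image.1 he
  obtain ⟨hab1, hab2⟩ := mem_filter.1 hab
  obtain ⟨⟨ha, hb⟩, hab3⟩ := mem_adjPairs.1 hab1
  have hne : (a, b) ≠ (-p - b, -p - a) := fun c =>
    (h.ne_of_sub_eq_one ha hab3).2 (congrArg Prod.snd c)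
  rw [← card_pair hne]
  congr 1
  ext ⟨u, v⟩
  simp only [mem_filter, mem_adjPairs, mem_insert, mem_singleton, Prod.mk.injEq]
  constructor
  · rintro ⟨⟨⟨⟨hu, hv⟩, huv⟩, -⟩, e⟩
    exact h.sub_eq_sub_iff hp hT ha hb hu hv hab3 e.symm
  · simp only at hab2 hab3
    rintro (⟨rfl, rfl⟩ | ⟨rfl, rfl⟩)
    · exact ⟨⟨⟨⟨ha, hb⟩, hab3⟩, hab2⟩, rfl⟩
    · have e : -p - b - (-p - a) = a - b := by abel
      refine ⟨⟨⟨⟨h.mate_mem_triads hb, h.mate_mem_triads ha⟩, by rwa [e]⟩, ?_⟩, e⟩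
      rw [map_sub, map_sub, hab2]

/-- The zero functional shows that every element off the lines through `p` and its triads is a
difference of adjacent triads; intersecting with the kernel of `y` gives the general case. -/
theorem two_mul_card_outer (h : IsDistanceScheme δ) [DecidableEq V] {p : V} (hp : δ p = 1)
    (hT : #(triads δ p) = 12) (y : V →ₗ[ZMod 3] ZMod 3) :
    2 * #(outer δ p y) = #{a ∈ adjPairs δ (triads δ p) | y a.1 = y a.2} := by
  have hsub : ∀ y : V →ₗ[ZMod 3] ZMod 3,
      {a ∈ adjPairs δ (triads δ p) | y a.1 = y a.2}.image (fun a => a.1 - a.2) ⊆ outer δ p y := by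
    intro y
    refine image_subset_iff.2 fun a ha => ?_
    obtain ⟨ha1, ha2⟩ := mem_filter.1 ha
    obtain ⟨⟨ha3, ha4⟩, ha5⟩ := mem_adjPairs.1 ha1
    exact h.sub_mem_outer hp ha3 ha4 ha5 ha2
  have hzero : outer δ p (0 : V →ₗ[ZMod 3] ZMod 3) = {a ∈ adjPairs δ (triads δ p) |
      (0 : V →ₗ[ZMod 3] ZMod 3) a.1 = (0 : V →ₗ[ZMod 3] ZMod 3) a.2}.image
        (fun a => a.1 - a.2) := by
    refine (eq_of_subset_of_card_le (hsub 0) ?_).symm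
    have h1 := h.card_adjPairs_filter hp hT 0
    have h2 := h.card_ker_eq hp (y := 0) rfl
    have h3 := h.two_mul_card_adjPairs hp (subset_refl (triads δ p))
      fun t ht => h.mate_mem_triads ht
    have h4 := h.card_sphere
    simp only [LinearMap.zero_apply, filter_true, and_true] at h1 h2 ⊢
    rw [hT] at h2 h3
    -- There are (144 - 24)/2 = 60 adjacent pairs, hence 30 differences, and 56 - 2 - 24 = 30
    -- elements off the lines.
    omega
  rw [h.card_adjPairs_filter hp hT y]
  congr 2
  refine subset_antisymm ?_ (hsub y)
  intro e he
  have he0 : e ∈ outer δ p (0 : V →ₗ[ZMod 3] ZMod 3) := by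
    simp only [outer, mem_filter_univ] at he ⊢
    exact ⟨he.1, rfl, he.2.2⟩
  rw [hzero] at he0
  obtain ⟨a, ha, rfl⟩ := mem_image.1 he0
  refine mem_image.2 ⟨a, mem_filter.2 ⟨(mem_filter.1 ha).1, ?_⟩, rfl⟩
  simp only [outer, mem_filter_univ] at he
  rw [← sub_eq_zero, ← map_sub, he.2.1]

/-- With `y` zero on four of the six lines, the hyperplane size is determined by its values at `i`
and `j`; only equal nonzero values give an admissible size. -/
theorem eq_of_vanishing (h : IsDistanceScheme δ) {p i j : V} (hp : δ p = 1)
    (hT : #(triads δ p) = 12) {y : V →ₗ[ZMod 3] ZMod 3} (hy : y ≠ 0) (hyp : y p = 0)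
    (hi : i ∈ triads δ p) (hj : j ∈ triads δ p) (hij : δ (i - j) = 1)
    (hv : ∀ t ∈ triads δ p, Skew p i t → Skew p j t → y t = 0) : y i ≠ 0 ∧ y i = y j := by
  classical
  let Z : Finset V := {t ∈ triads δ p | y t = 0}
  have ymate : ∀ a, y (-p - a) = -y a := by
    intro a
    rw [map_sub, map_neg, hyp, neg_zero, zero_sub]
  have hZT : Z ⊆ triads δ p := filter_subset _ _
  have hZmate : ∀ t ∈ Z, -p - t ∈ Z := by
    intro t ht
    obtain ⟨t1, t2⟩ := mem_filter.1 ht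
    exact mem_filter.2 ⟨h.mate_mem_triads t1, by rw [ymate, t2, neg_zero]⟩
  have hpairs : adjPairs δ Z ⊆ {a ∈ adjPairs δ (triads δ p) | y a.1 = y a.2} := by
    intro a ha
    obtain ⟨⟨a1, a2⟩, a3⟩ := mem_adjPairs.1 ha
    refine mem_filter.2 ⟨mem_adjPairs.2 ⟨⟨hZT a1, hZT a2⟩, a3⟩, ?_⟩
    rw [(mem_filter.1 a1).2, (mem_filter.1 a2).2]
  have k1 := h.card_ker hy
  have k2 := h.card_ker_eq hp hyp
  have k3 := h.two_mul_card_outer hp hT y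
  have k4 := h.two_mul_card_adjPairs hp hZT hZmate
  have k5 := card_le_card hpairs
  have hcover : triads δ p ⊆ Z ∪ {i, -p - i, j, -p - j} := by
    intro t ht
    by_cases c : t ∈ ({i, -p - i, j, -p - j} : Finset V)
    · exact mem_union_right _ c
    · simp only [mem_insert, mem_singleton, not_or] at c
      exact mem_union_left _ (mem_filter.2 ⟨ht, hv t ht ⟨c.1, c.2.1⟩ ⟨c.2.2.1, c.2.2.2⟩⟩)
  -- Ten zeros would already give at least 2 + 20 + 20 = 42 elements.
  have hlt : #Z < 10 := by
    by_contra! hge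
    have : 10 * #Z ≤ #Z * #Z := Nat.mul_le_mul_right _ hge
    simp only [Z] at *
    omega
  have key : ∀ a ∈ triads δ p, ∀ b, (∀ t, t ∈ ({i, -p - i, j, -p - j} : Finset V) →
      t ∈ ({a, -p - a, b, -p - b} : Finset V)) → y a ≠ 0 := by
    intro a ha b hab hya
    have haZ : a ∈ Z := mem_filter.2 ⟨ha, hya⟩
    have h1 : triads δ p ⊆ Z ∪ {b, -p - b} := by
      intro t ht
      rcases mem_union.1 (hcover ht) with c | c
      · exact mem_union_left _ c
      · have := hab t c
        simp only [mem_insert, mem_singleton] at this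
        rcases this with rfl | rfl | rfl | rfl
        · exact mem_union_left _ haZ
        · exact mem_union_left _ (hZmate _ haZ)
        · exact mem_union_right _ (by simp)
        · exact mem_union_right _ (by simp)
    have h2 := (card_le_card h1).trans ((card_union_le _ _).trans
      (Nat.add_le_add_left card_le_two _))
    omega
  have hyi : y i ≠ 0 := key i hi j fun t ht => ht
  have hyj : y j ≠ 0 := key j hj i fun t ht => by
    simp only [mem_insert, mem_singleton] at ht ⊢
    tauto
  refine ⟨hyi, ?_⟩
  by_contra hne
  have hZ8 : 8 ≤ #Z := by
    have h2 := (card_le_card hcover).trans ((card_union_le _ _).trans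
      (Nat.add_le_add_left card_le_four _))
    omega
  have hneg : ∀ a ∈ triads δ p, y a ≠ 0 → a = i ∨ a = -p - i ∨ a = j ∨ a = -p - j := by
    intro a ha hya
    rcases mem_union.1 (hcover ha) with c | c
    · exact absurd (mem_filter.1 c).2 hya
    · simpa using c
  have nij : δ (i - (-p - j)) ≠ 1 := h.not_sub_and_sub_mate hp hi hj hij
  have hpairs' : {a ∈ adjPairs δ (triads δ p) | y a.1 = y a.2} ⊆ adjPairs δ Z := by
    rintro ⟨a, b⟩ ha
    obtain ⟨ha1, ha2⟩ := mem_filter.1 ha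
    obtain ⟨⟨a1, a2⟩, a3⟩ := mem_adjPairs.1 ha1
    simp only at ha2 a1 a2 a3
    by_cases hya : y a = 0
    · exact mem_adjPairs.2 ⟨⟨mem_filter.2 ⟨a1, hya⟩, mem_filter.2 ⟨a2, ha2 ▸ hya⟩⟩, a3⟩
    exfalso
    have hyb : y b ≠ 0 := ha2 ▸ hya
    have sk := h.ne_of_sub_eq_one a1 a3
    have r1 : ∀ c d : V, (-p - c) - d = -(c - (-p - d)) := fun c d => by
      linear_combination (norm := (match_scalars <;> decide)) (0 : ZMod 3) • (rfl : c = c)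
    rcases hneg a a1 hya with rfl | rfl | rfl | rfl <;>
    rcases hneg b a2 hyb with rfl | rfl | rfl | rfl
    · exact sk.1 rfl
    · exact sk.2 rfl
    · exact hne ha2
    · exact nij a3
    · exact sk.2 (mate_mate _ _).symm
    · exact sk.1 rfl
    · rw [r1, h.neg] at a3
      exact nij a3
    · rw [ymate, ymate] at ha2
      exact hne (neg_injective ha2)
    · exact hne ha2.symm
    · rw [h.sub_comm, r1, h.neg] at a3
      exact nij a3
    · exact sk.1 rfl
    · exact sk.2 rfl
    · rw [h.sub_comm] at a3
      exact nij a3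
    · rw [ymate, ymate] at ha2
      exact hne (neg_injective ha2).symm
    · exact sk.2 (mate_mate _ _).symm
    · exact sk.1 rfl
  have k6 := card_le_card hpairs'
  have k7 : #Z = 8 ∨ #Z = 9 := by omega
  simp only [Z] at *
  -- Eight zeros give 24 adjacent pairs and 2 + 16 + 12 = 30 elements, an inadmissible size; nine
  -- zeros fail by parity.
  rcases k7 with k7 | k7 <;> rw [k7] at k4 <;> omega

/-- Let `A` be the five neighbours of `s` among the triads, one on each other line. Functionals `Y
j` vanish at `p` and on `A` except at `j`, with value 1 at `s` and `j`. Their differences show that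
`A` has no adjacent pair, and their sum separates all adjacent pairs of triads while vanishing on no
triad. -/
theorem tetrads_nonempty (h : IsDistanceScheme δ) {p : V} (hp : δ p = 1) : tetrads δ p ≠ ∅ := by
  classical
  intro hF
  have hT : #(triads δ p) = 12 := by
    have := h.card_triads_add_card_tetrads hp
    rwa [hF, card_empty, add_zero] at this
  obtain ⟨s, hs⟩ : (triads δ p).Nonempty := card_pos.1 (by omega)
  let A : Finset V := {t ∈ triads δ p | δ (s - t) = 1}
  have hA : #A = 5 := by
    have := h.two_mul_card_adj hp (subset_refl (triads δ p)) (fun t ht => h.mate_mem_triads ht) hs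
    simp only [A]
    omega
  have hAT : ∀ t ∈ A, t ∈ triads δ p ∧ δ (s - t) = 1 := fun t ht => mem_filter.1 ht
  have hcover : ∀ t ∈ triads δ p, t = s ∨ t = -p - s ∨ t ∈ A ∨ -p - t ∈ A := by
    intro t ht
    by_cases c1 : t = s
    · exact Or.inl c1
    by_cases c2 : t = -p - s
    · exact Or.inr (Or.inl c2)
    rcases (h.sub_eq_one_or_sub_mate_eq_one hp hs ht c1 c2).1 with c | c
    · exact Or.inr (Or.inr (Or.inl (mem_filter.2 ⟨ht, c.1⟩)))
    · exact Or.inr (Or.inr (Or.inr (mem_filter.2 ⟨h.mate_mem_triads ht, c.2⟩)))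
  have hex : ∀ j ∈ A, ∃ y : V →ₗ[ZMod 3] ZMod 3, y p = 0 ∧ (∀ k ∈ A, k ≠ j → y k = 0) ∧
      y s = 1 ∧ y j = 1 := by
    intro j hj
    obtain ⟨y, hy, hB⟩ := h.exists_functional (insert p (A.erase j)) (by
      refine (card_insert_le _ _).trans ?_
      rw [card_erase_of_mem hj, hA])
    have yp : y p = 0 := hB p (mem_insert_self _ _)
    have yA : ∀ k ∈ A, k ≠ j → y k = 0 := fun k hk hkj =>
      hB k (mem_insert_of_mem (mem_erase.2 ⟨hkj, hk⟩))
    obtain ⟨e1, e2⟩ := h.eq_of_vanishing hp hT hy yp hs (hAT j hj).1 (hAT j hj).2 (by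
      intro t ht st jt
      rcases hcover t ht with c | c | c | c
      · exact absurd c st.1
      · exact absurd c st.2
      · exact yA t c jt.1
      · have := yA _ c fun e => jt.2 (by rw [← e, mate_mate])
        rw [map_sub, map_neg, yp, neg_zero, zero_sub] at this
        exact neg_eq_zero.1 this)
    have hinv : y s * y s = 1 := by
      revert e1
      generalize y s = c
      revert c
      decide
    refine ⟨y s • y, ?_, fun k hk hkj => ?_, ?_, ?_⟩
    · rw [LinearMap.smul_apply, yp, smul_zero]
    · rw [LinearMap.smul_apply, yA k hk hkj, smul_zero]
    · rw [LinearMap.smul_apply, smul_eq_mul, hinv]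
    · rw [LinearMap.smul_apply, ← e2, smul_eq_mul, hinv]
  choose! Y Yp YA Ys Yj using hex
  -- `Y j - Y k` vanishes on the other four lines but takes opposite values at `j` and `k`, against
  -- `eq_of_vanishing`.
  have hnot : ∀ j ∈ A, ∀ k ∈ A, δ (j - k) ≠ 1 := by
    intro j hj k hk hjk
    have hne : k ≠ j := (h.ne_of_sub_eq_one (hAT j hj).1 hjk).1
    have ej : (Y j - Y k) j = 1 := by
      rw [LinearMap.sub_apply, Yj j hj, YA k hk j hj hne.symm, sub_zero]
    have ek : (Y j - Y k) k = -1 := by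
      rw [LinearMap.sub_apply, Yj k hk, YA j hj k hk hne, zero_sub]
    have ep : (Y j - Y k) p = 0 := by
      rw [LinearMap.sub_apply, Yp j hj, Yp k hk, sub_zero]
    have es : (Y j - Y k) s = 0 := by
      rw [LinearMap.sub_apply, Ys j hj, Ys k hk, sub_self]
    have eA : ∀ t ∈ A, t ≠ j → t ≠ k → (Y j - Y k) t = 0 := by
      intro t ht tj tk
      rw [LinearMap.sub_apply, YA j hj t ht tj, YA k hk t ht tk, sub_zero]
    have em : ∀ t, (Y j - Y k) (-p - t) = 0 → (Y j - Y k) t = 0 := by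
      intro t ht
      rw [map_sub, map_neg, ep, neg_zero, zero_sub] at ht
      exact neg_eq_zero.1 ht
    have hy0 : Y j - Y k ≠ 0 := by
      intro c
      rw [c, LinearMap.zero_apply] at ej
      exact absurd ej (by decide)
    obtain ⟨-, e2⟩ := h.eq_of_vanishing hp hT hy0 ep (hAT j hj).1 (hAT k hk).1 hjk (by
      intro t ht jt kt
      rcases hcover t ht with c | c | c | c
      · rw [c, es]
      · exact em t (by rw [c, mate_mate, es])
      · exact eA t c jt.1 kt.1
      · exact em t (eA _ c (fun e => jt.2 (by rw [← e, mate_mate]))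
          (fun e => kt.2 (by rw [← e, mate_mate]))))
    rw [ej, ek] at e2
    exact absurd e2 (by decide)
  let y : V →ₗ[ZMod 3] ZMod 3 := ∑ j ∈ A, Y j
  have yp : y p = 0 := by
    rw [LinearMap.sum_apply]
    exact sum_eq_zero fun j hj => Yp j hj
  -- The value is 5, which is -1 in `ZMod 3`.
  have ys : y s = -1 := by
    rw [LinearMap.sum_apply, sum_congr rfl fun j hj => Ys j hj, sum_const, hA]
    decide
  have yA : ∀ k ∈ A, y k = 1 := by
    intro k hk
    rw [LinearMap.sum_apply, sum_eq_single_of_mem k hk fun j hj hjk => YA j hj k hk hjk.symm,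
      Yj k hk]
  have ymate : ∀ a, y (-p - a) = -y a := by
    intro a
    rw [map_sub, map_neg, yp, neg_zero, zero_sub]
  have hval : ∀ t ∈ triads δ p, (y t = -1 ∧ (t = s ∨ -p - t ∈ A)) ∨
      (y t = 1 ∧ (t = -p - s ∨ t ∈ A)) := by
    intro t ht
    rcases hcover t ht with c | c | c | c
    · exact Or.inl ⟨by rw [c, ys], Or.inl c⟩
    · exact Or.inr ⟨by rw [c, ymate, ys, neg_neg], Or.inl c⟩
    · exact Or.inr ⟨yA t c, Or.inr c⟩
    · refine Or.inl ⟨?_, Or.inr c⟩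
      rw [← mate_mate p t, ymate, yA _ c]
  have hy0 : y ≠ 0 := by
    intro c
    rw [c, LinearMap.zero_apply] at ys
    exact absurd ys (by decide)
  have hker : {t ∈ triads δ p | y t = 0} = ∅ := by
    refine filter_eq_empty_iff.2 fun t ht c => ?_
    rcases hval t ht with ⟨e, -⟩ | ⟨e, -⟩ <;> rw [c] at e <;> exact absurd e (by decide)
  have key : ∀ a ∈ triads δ p, ∀ b ∈ triads δ p, (a = s ∨ -p - a ∈ A) → (b = s ∨ -p - b ∈ A) →
      δ (a - b) ≠ 1 := by
    intro a ha b hb ca cb hab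
    have sk := h.ne_of_sub_eq_one ha hab
    have ns : ∀ c ∈ triads δ p, -p - c ∈ A → δ (s - c) ≠ 1 := by
      intro c _ hc
      have := h.not_sub_and_sub_mate hp hs (hAT _ hc).1 (hAT _ hc).2
      rwa [mate_mate] at this
    rcases ca with rfl | ca <;> rcases cb with rfl | cb
    · exact sk.1 rfl
    · exact ns b hb cb hab
    · exact ns a ha ca (by rwa [h.sub_comm])
    · refine hnot _ cb _ ca ?_
      rwa [show -p - b - (-p - a) = a - b by abel]
  have hpairs : {a ∈ adjPairs δ (triads δ p) | y a.1 = y a.2} = ∅ := by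
    refine filter_eq_empty_iff.2 ?_
    rintro ⟨a, b⟩ hab c
    obtain ⟨⟨a1, a2⟩, a3⟩ := mem_adjPairs.1 hab
    simp only at a1 a2 a3 c
    rcases hval a a1 with ⟨e, ca⟩ | ⟨e, ca⟩ <;> rcases hval b a2 with ⟨e', cb⟩ | ⟨e', cb⟩
    · exact key a a1 b a2 ca cb a3
    · rw [e, e'] at c
      exact absurd c (by decide)
    · rw [e, e'] at c
      exact absurd c (by decide)
    · refine key _ (h.mate_mem_triads a2) _ (h.mate_mem_triads a1) ?_ ?_
        (by rwa [show -p - b - (-p - a) = a - b by abel])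
      · rcases cb with rfl | cb
        · exact Or.inl (mate_mate _ _)
        · exact Or.inr (by rwa [mate_mate])
      · rcases ca with rfl | ca
        · exact Or.inl (mate_mate _ _)
        · exact Or.inr (by rwa [mate_mate])
  have k1 := h.card_ker hy0
  have k2 := h.card_ker_eq hp yp
  have k3 := h.two_mul_card_outer hp hT y
  rw [hpairs, card_empty] at k3
  rw [hker, card_empty] at k2
  -- Only `±p` remain in the kernel, but 2 is not an admissible size.
  omega

theorem false_of_isDistanceScheme (h : IsDistanceScheme δ) : False := by
  obtain ⟨p, hp, hF⟩ := h.exists_tetrads_eq_empty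
  exact h.tetrads_nonempty hp hF

end IsDistanceScheme

end CharThree

/-! ### Reduction from the code to its coset graph. -/

/-- The indices of the neighbours of a word in the Hamming graph: a coordinate and a nonzero
amount to be added there. -/
def shifts : Finset (Fin 28 × ZMod 3) := {a | a.2 ≠ 0}

/-- The word of weight at most one with a given entry. -/
def shift (a : Fin 28 × ZMod 3) : Fin 28 → ZMod 3 := Pi.single a.1 a.2

theorem mem_shifts {a : Fin 28 × ZMod 3} : a ∈ shifts ↔ a.2 ≠ 0 := by simp [shifts]

theorem neg_mem_shifts {a : Fin 28 × ZMod 3} (ha : a ∈ shifts) : (a.1, -a.2) ∈ shifts :=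
  mem_shifts.2 (neg_ne_zero.2 (mem_shifts.1 ha))

theorem shift_neg (a : Fin 28 × ZMod 3) : shift (a.1, -a.2) = -shift a := Pi.single_neg _ _

theorem shift_injOn : Set.InjOn shift shifts := by
  rintro ⟨i, c⟩ hi ⟨j, d⟩ hj e
  have hc : c ≠ 0 := mem_shifts.1 hi
  have h1 := congrFun e i
  simp only [shift, Pi.single_eq_same] at h1
  by_cases hij : i = j
  · subst hij
    rw [Pi.single_eq_same] at h1
    rw [h1]
  · rw [Pi.single_eq_of_ne hij] at h1
    exact absurd h1 hc

theorem card_shifts : #shifts = 56 := by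
  have : shifts = univ ×ˢ ({1, -1} : Finset (ZMod 3)) := by
    ext a
    simp only [mem_shifts, mem_product, mem_univ, true_and]
    generalize a.2 = c
    revert c
    decide
  rw [this, card_product, card_univ, Fintype.card_fin]
  decide

theorem hammingDist_eq_one_iff (v w : Fin 28 → ZMod 3) :
    hammingDist v w = 1 ↔ ∃ a ∈ shifts, w = v + shift a := by
  rw [hammingDist, card_eq_one]
  constructor
  · rintro ⟨i, hi⟩
    have hmem : ∀ j, v j ≠ w j ↔ j = i := by
      intro j
      have := congrArg (j ∈ ·) hi
      simpa using this
    refine ⟨(i, w i - v i), mem_shifts.2 (sub_ne_zero.2 ((hmem i).2 rfl).symm), ?_⟩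
    ext j
    by_cases hj : j = i
    · subst hj
      simp [shift]
    · have h1 : v j = w j := by
        by_contra hne
        exact hj ((hmem j).1 hne)
      simp [shift, hj, h1]
  · rintro ⟨⟨i, c⟩, ha, rfl⟩
    have hc : c ≠ 0 := mem_shifts.1 ha
    refine ⟨i, ?_⟩
    ext j
    by_cases hj : j = i
    · subst hj
      simp [shift, hc]
    · simp [shift, hj]

section Reduction

variable {C : Submodule (ZMod 3) (Fin 28 → ZMod 3)} {κ : (Fin 28 → ZMod 3) → Fin 4}

theorem exists_class_function
    (hC : IsCompletelyRegularCode (hammingGraph 28 (ZMod 3)) (C : Set (Fin 28 → ZMod 3))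
      ![56, 42, 20] ![1, 6, 28]) :
    ∃ κ : (Fin 28 → ZMod 3) → Fin 4, (∀ v, κ v = 0 ↔ v ∈ C) ∧
      ∀ v j, #{a ∈ shifts | κ (v + shift a) = j} = intersectionMatrix (κ v) j := by
  obtain ⟨P, S, hE, hP0, htri, hb, hc⟩ := hC
  choose κ hκ hκ' using hE.existsUnique_mem
  have hmem : ∀ v j, v ∈ P j ↔ κ v = j := by
    intro v j
    exact ⟨fun hv => (hκ' v j hv).symm, fun e => e ▸ hκ v⟩
  have hcount : ∀ v j, #{a ∈ shifts | κ (v + shift a) = j} = S (κ v) j := by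
    intro v j
    have h1 := hE.encard_inter (κ v) j v (hκ v)
    have h2 : (hammingGraph 28 (ZMod 3)).neighborSet v ∩ P j =
        (({a ∈ shifts | κ (v + shift a) = j}.image fun a => v + shift a : Finset _) :
          Set (Fin 28 → ZMod 3)) := by
      ext w
      simp only [Set.mem_inter_iff, SimpleGraph.mem_neighborSet, hammingGraph, hmem,
        hammingDist_eq_one_iff, coe_image, Set.mem_image, mem_coe, mem_filter]
      constructor
      · rintro ⟨⟨a, ha, rfl⟩, hw⟩
        exact ⟨a, ⟨ha, hw⟩, rfl⟩
      · rintro ⟨a, ⟨ha, hw⟩, rfl⟩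
        exact ⟨⟨a, ha, rfl⟩, hw⟩
    rw [h2, Set.encard_coe_eq_coe_finsetCard, card_image_of_injOn] at h1
    · exact_mod_cast h1
    · intro a ha b hb e
      exact shift_injOn (mem_filter.1 ha).1 (mem_filter.1 hb).1 (add_left_cancel e)
  -- The graph has valency 56, so row sums recover the diagonal entries that the intersection array
  -- leaves out.
  have hrow : ∀ i, S i 0 + S i 1 + S i 2 + S i 3 = 56 := by
    intro i
    obtain ⟨v, hv⟩ := hE.nonempty i
    rw [hmem] at hv
    rw [← hv, ← hcount, ← hcount, ← hcount, ← hcount, ← card_shifts,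
      card_eq_sum_card_fiberwise (s := shifts) (f := fun a => κ (v + shift a)) (t := univ)
        (fun _ _ => mem_coe.2 (mem_univ _)), Fin.sum_univ_four]
  have hS : ∀ i j, S i j = intersectionMatrix i j := by
    have b0 : S 0 1 = 56 := hb 0
    have b1 : S 1 2 = 42 := hb 1
    have b2 : S 2 3 = 20 := hb 2
    have c0 : S 1 0 = 1 := hc 0
    have c1 : S 2 1 = 6 := hc 1
    have c2 : S 3 2 = 28 := hc 2
    have t02 : S 0 2 = 0 := htri 0 2 (by decide)
    have t03 : S 0 3 = 0 := htri 0 3 (by decide)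
    have t13 : S 1 3 = 0 := htri 1 3 (by decide)
    have t20 : S 2 0 = 0 := htri 2 0 (by decide)
    have t30 : S 3 0 = 0 := htri 3 0 (by decide)
    have t31 : S 3 1 = 0 := htri 3 1 (by decide)
    have r0 := hrow 0
    have r1 := hrow 1
    have r2 := hrow 2
    have r3 := hrow 3
    have d0 : S 0 0 = 0 := by omega
    have d1 : S 1 1 = 13 := by omega
    have d2 : S 2 2 = 30 := by omega
    have d3 : S 3 3 = 28 := by omega
    intro i j
    fin_cases i <;> fin_cases j <;> assumption
  refine ⟨κ, fun v => ?_, fun v j => (hcount v j).trans (hS _ _)⟩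
  rw [← hmem, hP0, SetLike.mem_coe]

theorem exists_shift_iff
    (hκ : ∀ v j, #{a ∈ shifts | κ (v + shift a) = j} = intersectionMatrix (κ v) j)
    (v : Fin 28 → ZMod 3) (j : Fin 4) :
    (∃ a ∈ shifts, κ (v + shift a) = j) ↔ intersectionMatrix (κ v) j ≠ 0 := by
  rw [← hκ, card_ne_zero]
  constructor
  · rintro ⟨a, ha, e⟩
    exact ⟨a, mem_filter.2 ⟨ha, e⟩⟩
  · rintro ⟨a, ha⟩
    exact ⟨a, mem_filter.1 ha⟩

/-- An automorphism of the Hamming graph that fixes the code fixes the classes. -/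
theorem class_invariant
    (hκ : ∀ v j, #{a ∈ shifts | κ (v + shift a) = j} = intersectionMatrix (κ v) j)
    {σ : (Fin 28 → ZMod 3) → (Fin 28 → ZMod 3)} (τ : Fin 28 × ZMod 3 → Fin 28 × ZMod 3)
    (h0 : ∀ v, κ (σ v) = 0 ↔ κ v = 0) (hτ : ∀ a ∈ shifts, τ a ∈ shifts)
    (hττ : ∀ a, τ (τ a) = a) (hσ : ∀ v a, σ (v + shift a) = σ v + shift (τ a))
    (v : Fin 28 → ZMod 3) : κ (σ v) = κ v := by
  have step : ∀ j, (∀ v, κ (σ v) = j ↔ κ v = j) → ∀ v,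
      intersectionMatrix (κ (σ v)) j ≠ 0 ↔ intersectionMatrix (κ v) j ≠ 0 := by
    intro j hj v
    rw [← exists_shift_iff hκ, ← exists_shift_iff hκ]
    constructor
    · rintro ⟨a, ha, e⟩
      refine ⟨τ a, hτ a ha, (hj _).1 ?_⟩
      rw [hσ, hττ, e]
    · rintro ⟨a, ha, e⟩
      refine ⟨τ a, hτ a ha, ?_⟩
      rw [← hσ]
      exact (hj _).2 e
  have e1 : ∀ i, i = 1 ↔ i ≠ 0 ∧ intersectionMatrix i 0 ≠ 0 := by decide
  have e2 : ∀ i, i = 2 ↔ i ≠ 0 ∧ i ≠ 1 ∧ intersectionMatrix i 1 ≠ 0 := by decide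
  have h1 : ∀ v, κ (σ v) = 1 ↔ κ v = 1 := fun v => by
    rw [e1, e1 (κ v), step 0 h0 v, Ne, h0 v]
  have h2 : ∀ v, κ (σ v) = 2 ↔ κ v = 2 := fun v => by
    rw [e2, e2 (κ v), step 1 h1 v, Ne, Ne, h0 v, h1 v]
  have e3 : ∀ i j : Fin 4, (i = 0 ↔ j = 0) → (i = 1 ↔ j = 1) → (i = 2 ↔ j = 2) → i = j := by
    decide
  exact e3 _ _ (h0 v) (h1 v) (h2 v)

/-- Translations by codewords and negation preserve the code, hence the classes, which descend to
the quotient. As `c_1 = 1`, the 56 words of weight one lie in distinct cosets, so neighbour counts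
also descend. -/
theorem exists_isDistanceScheme [Fintype ((Fin 28 → ZMod 3) ⧸ C)] (hC : ∀ v, κ v = 0 ↔ v ∈ C)
    (hκ : ∀ v j, #{a ∈ shifts | κ (v + shift a) = j} = intersectionMatrix (κ v) j) :
    ∃ δ : (Fin 28 → ZMod 3) ⧸ C → Fin 4, IsDistanceScheme δ := by
  have hadd : ∀ c ∈ C, ∀ v, κ (v + c) = κ v := by
    intro c hc v
    refine class_invariant hκ (σ := fun v => v + c) id (fun v => ?_) (fun a ha => ha)
      (fun _ => rfl) (fun v a => ?_) v
    · rw [hC, hC]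
      exact C.add_mem_iff_left hc
    · exact add_right_comm _ _ _
  have hneg : ∀ v, κ (-v) = κ v := by
    intro v
    refine class_invariant hκ (σ := fun v => -v) (fun a => (a.1, -a.2)) (fun v => ?_)
      (fun a ha => neg_mem_shifts ha) (fun a => by simp) (fun v a => ?_) v
    · rw [hC, hC]
      exact C.neg_mem_iff
    · simp only [shift_neg, neg_add]
  obtain ⟨δ, hδ⟩ : ∃ δ : (Fin 28 → ZMod 3) ⧸ C → Fin 4, ∀ v, δ (C.mkQ v) = κ v := by
    refine ⟨fun q => κ (Function.surjInv C.mkQ_surjective q), fun v => ?_⟩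
    have h1 := Function.surjInv_eq C.mkQ_surjective (C.mkQ v)
    have h2 := (Submodule.Quotient.eq C).1 h1
    rw [← hadd _ h2 v, add_sub_cancel]
  refine ⟨δ, fun x => ?_, fun x => ?_, fun x j => ?_⟩
  · obtain ⟨v, rfl⟩ := C.mkQ_surjective x
    rw [hδ, hC, Submodule.mkQ_apply, Submodule.Quotient.mk_eq_zero]
  · obtain ⟨v, rfl⟩ := C.mkQ_surjective x
    rw [← map_neg, hδ, hδ, hneg]
  obtain ⟨v, rfl⟩ := C.mkQ_surjective x
  have hone : ∀ a ∈ shifts, κ (shift a) = 1 := by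
    intro a ha
    have h1 := (exists_shift_iff hκ 0 (κ (shift a))).1 ⟨a, ha, by rw [zero_add]⟩
    rw [(hC 0).2 C.zero_mem] at h1
    revert h1
    generalize κ (shift a) = i
    revert i
    decide
  rw [hδ, ← hκ v j]
  symm
  -- The sign makes `v - s` the coset of the neighbour `v + shift a`.
  refine card_bij (fun a _ => C.mkQ (-shift a)) ?_ ?_ ?_
  · intro a ha
    obtain ⟨ha, ha'⟩ := mem_filter.1 ha
    rw [mem_filter_univ, ← map_sub, hδ, hδ, hneg, sub_neg_eq_add]
    exact ⟨hone a ha, ha'⟩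
  · intro a ha b hb e
    replace ha := (mem_filter.1 ha).1
    replace hb := (mem_filter.1 hb).1
    have h1 := (Submodule.Quotient.eq C).1 e
    have h2 := hκ (shift a) 0
    rw [hone a ha, show intersectionMatrix 1 0 = 1 from rfl, card_eq_one] at h2
    obtain ⟨d, hd⟩ := h2
    have m1 : (a.1, -a.2) ∈ {c ∈ shifts | κ (shift a + shift c) = 0} := by
      refine mem_filter.2 ⟨neg_mem_shifts ha, ?_⟩
      rw [shift_neg, add_neg_cancel, hC]
      exact C.zero_mem
    have m2 : (b.1, -b.2) ∈ {c ∈ shifts | κ (shift a + shift c) = 0} := by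
      refine mem_filter.2 ⟨neg_mem_shifts hb, ?_⟩
      rw [shift_neg, hC, ← C.neg_mem_iff]
      rwa [neg_add, ← sub_eq_add_neg]
    rw [hd, mem_singleton] at m1 m2
    obtain ⟨e1, e2⟩ := Prod.mk.inj (m1.trans m2.symm)
    exact Prod.ext e1 (neg_injective e2)
  · intro s hs
    obtain ⟨w, rfl⟩ := C.mkQ_surjective s
    rw [mem_filter_univ, ← map_sub, hδ, hδ] at hs
    obtain ⟨hs1, hs2⟩ := hs
    obtain ⟨a, ha, ha'⟩ := (exists_shift_iff hκ w 0).2 (by rw [hs1]; decide)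
    rw [hC] at ha'
    refine ⟨a, mem_filter.2 ⟨ha, ?_⟩, ?_⟩
    · rw [← hs2, ← hadd _ ha' (v - w)]
      congr 1
      abel
    · refine (Submodule.Quotient.eq C).2 ?_
      rw [← C.neg_mem_iff]
      convert ha' using 1
      abel

end Reduction
end DistanceScheme

theorem corollary5 :
    ¬ ∃ C : Submodule (ZMod 3) (Fin 28 → ZMod 3),
      IsCompletelyRegularCode (hammingGraph 28 (ZMod 3)) (C : Set (Fin 28 → ZMod 3))
        ![56, 42, 20] ![1, 6, 28] := by
  rintro ⟨C, hC⟩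
  obtain ⟨κ, h0, hκ⟩ := DistanceScheme.exists_class_function hC
  have : Fintype ((Fin 28 → ZMod 3) ⧸ C) := Fintype.ofFinite _
  obtain ⟨δ, hδ⟩ := DistanceScheme.exists_isDistanceScheme h0 hκ
  exact hδ.false_of_isDistanceScheme
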